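/- Let $X$ be a compact metric space with metric $\rho$, and define its derived sets by $X^{(0)}=X$, $X^{(\gamma+1)}=$ the set of accumulation points of $X^{(\gamma)}$, and $X^{(\lambda)}=\bigcap_{\gamma<\lambda}X^{(\gamma)}$ for limit ordinals $\lambda$. Suppose that $X$ has derived degree $\alpha\ge 2$, i.e. $X^{(\alpha)}\neq\emptyset$ and $X^{(\alpha+1)}=\emptyset$ (such an $X$ is necessarily countable, and every nonempty countable compact metric space has a derived degree). For a homeomorphism $T\colon X\to X$, $x\in X$ and $\delta>0$ put $\Gamma_\delta[x,T]=\{y\in X : \rho(T^kx,T^ky)\le\delta \text{ for all } k\in\mathbb Z\}$. For an integer $m\ge 0$, call $T$ $m$-expansive if there is $\delta>0$ such that $\Gamma_\delta[x,T]$ has at most $m$ elements for every $x\in X$. Let $n\ge 1$ be an integer. Then $X$ admits an essentially $n$-expansive homeomorphism, i.e. a homeomorphism $T\colon X\to X$ that is $n$-expansive but not $(n-1)$-expansive, if and only if $\alpha$ is not a limit ordinal. -/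

import Mathlib

universe u

/-- The set of points of `X` whose whole two-sided `T`-orbit stays `δ`-close to the orbit of `x`:
`Γ_δ[x, T] = {y : d (T ^ k x) (T ^ k y) ≤ δ for all k ∈ ℤ}`. Powers are taken in Mathlib's group
of self-homeomorphisms of `X`, whose product is composition. -/
def dynamicalBall {X : Type*} [MetricSpace X] (T : X ≃ₜ X) (δ : ℝ) (x : X) : Set X :=
  {y | ∀ k : ℤ, dist ((T ^ k) x) ((T ^ k) y) ≤ δ}

/-- `T` is `n`-expansive: for some `δ > 0` every `Γ_δ[x, T]` has at most `n` elements.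
(For `n = 0` this holds only on the empty space.) -/
def IsNExpansive {X : Type*} [MetricSpace X] (n : ℕ) (T : X ≃ₜ X) : Prop :=
  ∃ δ : ℝ, 0 < δ ∧ ∀ x : X, (dynamicalBall T δ x).encard ≤ n

/-- For `n ≥ 1`: `T` is essentially `n`-expansive, i.e. `n`-expansive but not
`(n - 1)`-expansive. -/
def IsEssentiallyNExpansive {X : Type*} [MetricSpace X] (n : ℕ) (T : X ≃ₜ X) : Prop :=
  IsNExpansive n T ∧ ¬ IsNExpansive (n - 1) T

/-- `X` has derived degree `α`: the `α`-th derived set of `X` is nonempty and the `(α + 1)`-st is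
empty. Here `X^(0) = X`, `X^(α + 1) = (X^(α))^d`, and intersections are taken at limits. -/
def HasDerivedDegree (X : Type u) [TopologicalSpace X] (α : Ordinal.{u}) : Prop :=
  (CantorBendixson.iteratedDerivedSet (Set.univ : Set X) α).Nonempty ∧
    CantorBendixson.iteratedDerivedSet (Set.univ : Set X) (α + 1) = ∅

/-! Everything is expressed through the Cantor-Bendixson rank of a point: the largest `γ` with the
point in the `γ`-th derived set. It is invariant under homeomorphisms, and only finitely many points
have the top rank `α`.

If `α` is a limit, take a small `ε` and the points that lie `ε`-close to some top point `q` but are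
moved by `T` or `T⁻¹` to distance at least `ε` from the image of `q`. They form a compact set
without top points, so their ranks stay below some `β < α`. Points of rank at least `β` near a top
point therefore stay close for all time; there are infinitely many, and no `T` is `m`-expansive for
any `m`.

If `α = β + 1` with `β > 0`, a model system is built and transported to `X`. Let `K` be a clopen
neighbourhood of a point `q` of rank `β` whose other points have smaller rank. Choose clopen sets
avoiding `q` whose membership patterns have fibres of at most `n` points, with `n`-point fibres
arbitrarily close to `q` (`exists_blockCode`). Encode `y ∈ K` by a bi-infinite sequence with a mark
at `0`, a mark at `3 ^ i` whenever `y` lies in block `i`, and the letter `y` at `0`. All translates,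
together with one fixed point, form a compact shift space in which translates keep the rank of `y`
and the fixed point has rank `β + 1`. The marks alone recover the translate and the fibre of `y`,
which gives `n`-expansiveness. Points of one fibre near `q` differ by a single small letter, so `n -
1` does not suffice.

By the Mazurkiewicz-Sierpiński theorem (`IsCBRank.nonempty_homeomorph`), `X` is homeomorphic to a
disjoint union of copies of this space, one for each point of rank `α`. -/

open Set Filter Topology Uniformity

universe v w

/-! ### Cantor-Bendixson ranks -/

/-- A rank function on a topological space which behaves like the Cantor-Bendixson rank. -/
structure IsCBRank {X : Type*} [TopologicalSpace X] (r : X → Ordinal) : Prop where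
  eventually_lt : ∀ x, ∀ᶠ y in 𝓝[≠] x, r y < r x
  frequently_le : ∀ x, ∀ γ < r x, ∃ᶠ y in 𝓝[≠] x, γ ≤ r y

namespace IsCBRank

variable {X : Type*} [TopologicalSpace X] {r : X → Ordinal}

theorem eventually_ne_imp_lt (hr : IsCBRank r) (x : X) : ∀ᶠ y in 𝓝 x, y ≠ x → r y < r x :=
  eventually_nhdsWithin_iff.1 (hr.eventually_lt x)

/-- A space carrying a Cantor-Bendixson rank is scattered, hence totally disconnected. -/
theorem totallyDisconnectedSpace [T1Space X] (hr : IsCBRank r) : TotallyDisconnectedSpace X := by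
  refine ⟨fun C _ hC => ?_⟩
  by_contra hsub
  have hnt : C.Nontrivial := Set.not_subsingleton_iff.1 hsub
  -- A point of least rank is isolated in `C`, which a nontrivial preconnected set does not allow.
  obtain ⟨x, hxC, hx⟩ := WellFounded.has_min (InvImage.wf r Ordinal.lt_wf) C hnt.nonempty
  have hacc := hC.preperfect_of_nontrivial hnt x hxC
  rw [accPt_iff_frequently_nhdsNE] at hacc
  obtain ⟨y, hyC, hy⟩ := (hacc.and_eventually (hr.eventually_lt x)).exists
  exact hx y hyC hy

/-- Each point has a neighbourhood where its rank is strictly largest; finitely many of these cover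
`A`, and one of their centres wins. The same cover shows in `finite_top` that every top point is a
centre. -/
theorem exists_mem_isMax (hr : IsCBRank r) {A : Set X} (hA : IsCompact A) (hne : A.Nonempty) :
    ∃ x ∈ A, ∀ y ∈ A, r y ≤ r x := by
  obtain ⟨t, htA, ht⟩ := hA.elim_nhds_subcover (fun x => {y | y ≠ x → r y < r x})
    fun x _ => hr.eventually_ne_imp_lt x
  have key : ∀ y ∈ A, ∃ x ∈ t, r y ≤ r x := by
    intro y hy
    obtain ⟨x, hxt, hx⟩ := mem_iUnion₂.1 (ht hy)
    refine ⟨x, hxt, ?_⟩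
    by_cases h : y = x
    · rw [h]
    · exact (hx h).le
  have htne : t.Nonempty := by
    obtain ⟨y, hy⟩ := hne
    obtain ⟨x, hx, -⟩ := key y hy
    exact ⟨x, hx⟩
  obtain ⟨x, hxt, hx⟩ := t.exists_max_image r htne
  refine ⟨x, htA x hxt, fun y hy => ?_⟩
  obtain ⟨z, hz, hyz⟩ := key y hy
  exact hyz.trans (hx z hz)

theorem finite_top (hr : IsCBRank r) {A : Set X} (hA : IsCompact A) {γ : Ordinal}
    (hγ : ∀ x ∈ A, r x ≤ γ) : (A ∩ r ⁻¹' {γ}).Finite := by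
  obtain ⟨t, htA, ht⟩ := hA.elim_nhds_subcover (fun x => {y | y ≠ x → r y < r x})
    fun x _ => hr.eventually_ne_imp_lt x
  refine t.finite_toSet.subset fun y hy => ?_
  obtain ⟨x, hxt, hx⟩ := mem_iUnion₂.1 (ht hy.1)
  by_cases h : y = x
  · exact h ▸ hxt
  · have h1 := hx h
    rw [show r y = γ from hy.2] at h1
    exact absurd (hγ x (htA x hxt)) h1.not_ge

/-- A point of least rank among those of rank at least `γ` in `U` must have rank `γ`: otherwise
points of rank at least `γ` but smaller than its own accumulate at it. -/
theorem exists_mem_eq (hr : IsCBRank r) {U : Set X} (hU : IsOpen U) {x : X} (hx : x ∈ U)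
    {γ : Ordinal} (hγ : γ ≤ r x) : ∃ z ∈ U, r z = γ := by
  obtain ⟨z, ⟨hzU, hzγ⟩, hz⟩ := WellFounded.has_min (InvImage.wf r Ordinal.lt_wf)
    (U ∩ {z | γ ≤ r z}) ⟨x, hx, hγ⟩
  refine ⟨z, hzU, le_antisymm (not_lt.1 fun hlt => ?_) hzγ⟩
  obtain ⟨y, hy, hyU, hyz⟩ := ((hr.frequently_le z γ hlt).and_eventually
    ((eventually_nhdsWithin_of_eventually_nhds (hU.eventually_mem hzU)).and
      (hr.eventually_lt z))).exists
  exact hz y ⟨hyU, hy⟩ hyz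

theorem infinite_eq [T1Space X] (hr : IsCBRank r) {U : Set X} (hU : IsOpen U) {x : X}
    (hx : x ∈ U) {γ : Ordinal} (hγ : γ < r x) : (U ∩ r ⁻¹' {γ}).Infinite := by
  intro hfin
  have hxn : x ∉ U ∩ r ⁻¹' {γ} := fun h => hγ.ne h.2.symm
  obtain ⟨z, ⟨hzU, hz⟩, hzγ⟩ := hr.exists_mem_eq (hU.inter hfin.isClosed.isOpen_compl)
    ⟨hx, hxn⟩ hγ.le
  exact hz ⟨hzU, hzγ⟩

/-- Cantor-Bendixson ranks are unique. -/
theorem le_of_isCBRank {s : X → Ordinal} (hr : IsCBRank r) (hs : IsCBRank s) :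
    ∀ γ : Ordinal, ∀ x, γ ≤ r x → γ ≤ s x := by
  intro γ
  induction γ using WellFoundedLT.induction with
  | ind γ ih =>
    intro x hx
    by_contra! hlt
    -- Near `x` some `y` has `r`-rank at least `s x`, hence by induction `s`-rank at least `s x`;
    -- but nearby `s`-ranks lie below `s x`.
    obtain ⟨y, hy, hys⟩ := ((hr.frequently_le x (s x) (hlt.trans_le hx)).and_eventually
      (hs.eventually_lt x)).exists
    exact (ih (s x) hlt y hy).not_gt hys

theorem comp_isOpenEmbedding {Y : Type*} [TopologicalSpace Y] (hr : IsCBRank r) {f : Y → X}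
    (hf : IsOpenEmbedding f) : IsCBRank (r ∘ f) := by
  have key : ∀ y, map f (𝓝[≠] y) = 𝓝[≠] (f y) := by
    intro y
    have himg : f '' {y}ᶜ = range f ∩ {f y}ᶜ := by
      ext z
      constructor
      · rintro ⟨w, hw, rfl⟩
        exact ⟨mem_range_self w, fun h => hw (hf.injective h)⟩
      · rintro ⟨⟨w, rfl⟩, hz⟩
        exact ⟨w, fun h => hz (congrArg f h), rfl⟩
    rw [nhdsWithin, Filter.map_inf hf.injective, hf.map_nhds_eq, map_principal, himg,
      ← nhdsWithin]
    exact nhdsWithin_inter_of_mem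
      (mem_nhdsWithin_of_mem_nhds (hf.isOpen_range.mem_nhds (mem_range_self y)))
  constructor
  · intro y
    have := hr.eventually_lt (f y)
    rwa [← key, eventually_map] at this
  · intro y γ hγ
    have := hr.frequently_le (f y) γ hγ
    rwa [← key, frequently_map] at this

theorem homeomorph_apply (hr : IsCBRank r) (T : X ≃ₜ X) (x : X) : r (T x) = r x :=
  le_antisymm ((hr.comp_isOpenEmbedding T.isOpenEmbedding).le_of_isCBRank hr _ x le_rfl)
    (hr.le_of_isCBRank (hr.comp_isOpenEmbedding T.isOpenEmbedding) _ x le_rfl)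

end IsCBRank

/-! ### Back-and-forth with clopen partitions -/

/-- A pair of finite clopen partitions of `X` and `Y`, indexed by `ℕ`, whose parts are
related by `R`. -/
structure ClopenMatching {X Y : Type*} [TopologicalSpace X] [TopologicalSpace Y]
    (R : Set X → Set Y → Prop) where
  left : X → ℕ
  right : Y → ℕ
  left_locallyConstant : IsLocallyConstant left
  right_locallyConstant : IsLocallyConstant right
  rel : ∀ i, R (left ⁻¹' {i}) (right ⁻¹' {i})

namespace ClopenMatching

variable {X Y : Type*} [TopologicalSpace X] [TopologicalSpace Y] {R : Set X → Set Y → Prop}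

/-- Exchange the two sides of a matching. -/
def swap (P : ClopenMatching R) : ClopenMatching (fun B A => R A B) where
  left := P.right
  right := P.left
  left_locallyConstant := P.right_locallyConstant
  right_locallyConstant := P.left_locallyConstant
  rel := P.rel

theorem exists_refine_left
    (forth : ∀ A B A', IsClopen A → IsClopen B → IsClopen A' → A' ⊆ A → R A B →
      ∃ B' ⊆ B, IsClopen B' ∧ R A' B' ∧ R (A \ A') (B \ B'))
    (P : ClopenMatching R) {A : Set X} (hA : IsClopen A) :
    ∃ Q : ClopenMatching R, (∀ x, Q.left x / 2 = P.left x) ∧ (∀ y, Q.right y / 2 = P.right y) ∧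
      ∀ x, Q.left x % 2 = 1 ↔ x ∈ A := by
  classical
  have hl : ∀ i, IsClopen (P.left ⁻¹' {i}) := fun i => P.left_locallyConstant.isClopen_fiber i
  have hr : ∀ i, IsClopen (P.right ⁻¹' {i}) := fun i => P.right_locallyConstant.isClopen_fiber i
  choose B hBs hBc hB1 hB2 using fun i => forth _ _ (P.left ⁻¹' {i} ∩ A) (hl i) (hr i)
    ((hl i).inter hA) inter_subset_left (P.rel i)
  -- The new index is twice the old one plus a bit for membership in the splitting set, so halving
  -- recovers the parent part and parity the side.
  have key1 : ∀ a b c : ℕ, b < 2 → (2 * a + b = c ↔ a = c / 2 ∧ b = c % 2) := by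
    intro a b c hb; omega
  have ite_lt : ∀ p : Prop, (if p then 1 else 0 : ℕ) < 2 := by
    intro p; split_ifs <;> omega
  have eL : ∀ c, (fun x => 2 * P.left x + if x ∈ A then 1 else 0) ⁻¹' {c} =
      if c % 2 = 1 then P.left ⁻¹' {c / 2} ∩ A else P.left ⁻¹' {c / 2} \ (P.left ⁻¹' {c / 2} ∩ A) := by
    intro c
    ext x
    simp only [mem_preimage, mem_singleton_iff, key1 _ _ _ (ite_lt _)]
    split_ifs with h1 h2 h2 <;> simp_all
  have eR : ∀ c, (fun y => 2 * P.right y + if y ∈ B (P.right y) then 1 else 0) ⁻¹' {c} =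
      if c % 2 = 1 then B (c / 2) else P.right ⁻¹' {c / 2} \ B (c / 2) := by
    intro c
    ext y
    have hBy : ∀ i, y ∈ B i → P.right y = i := fun i h => hBs i h
    simp only [mem_preimage, mem_singleton_iff, key1 _ _ _ (ite_lt _)]
    split_ifs with h1 h2 h2
    · refine ⟨fun h => h.1 ▸ h1, fun h => ⟨hBy _ h, h2.symm⟩⟩
    · simp only [Set.mem_sdiff, mem_preimage, mem_singleton_iff]
      refine ⟨fun h => by omega, fun h => absurd (h.1 ▸ h1) h.2⟩
    · refine ⟨fun h => by omega, fun h => absurd ((hBy _ h).symm ▸ h) h1⟩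
    · simp only [Set.mem_sdiff, mem_preimage, mem_singleton_iff]
      refine ⟨fun h => ⟨h.1, h.1 ▸ h1⟩, fun h => ⟨h.1, by omega⟩⟩
  refine ⟨⟨fun x => 2 * P.left x + if x ∈ A then 1 else 0,
    fun y => 2 * P.right y + if y ∈ B (P.right y) then 1 else 0, ?_, ?_, ?_⟩, ?_, ?_, ?_⟩
  · refine (IsLocallyConstant.iff_isOpen_fiber).2 fun c => ?_
    rw [eL]
    split_ifs
    · exact ((hl _).inter hA).isOpen
    · exact ((hl _).diff ((hl _).inter hA)).isOpen
  · refine (IsLocallyConstant.iff_isOpen_fiber).2 fun c => ?_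
    rw [eR]
    split_ifs
    · exact (hBc _).isOpen
    · exact ((hr _).diff (hBc _)).isOpen
  · intro c
    rw [eL, eR]
    split_ifs
    · exact hB1 _
    · exact hB2 _
  · intro x
    have := ite_lt (x ∈ A)
    dsimp only
    omega
  · intro y
    have := ite_lt (y ∈ B (P.right y))
    dsimp only
    omega
  · intro x
    dsimp only
    split_ifs with h <;> simp [h]

end ClopenMatching

/-- The fibres of `f k` over `g k y` are nested, nonempty and clopen, so compactness gives a point
with the same code as `y`. -/
theorem range_subset_range_of_compatible {X Y : Type*} [TopologicalSpace X] [CompactSpace X]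
    {f : ℕ → X → ℕ} {g : ℕ → Y → ℕ} {t : ℕ → ℕ} (hf : ∀ k, IsLocallyConstant (f k))
    (hft : ∀ k x, t (f (k + 1) x) = f k x) (hgt : ∀ k y, t (g (k + 1) y) = g k y)
    (hne : ∀ k y, ∃ x, f k x = g k y) :
    range (fun y k => g k y) ⊆ range (fun x k => f k x) := by
  rintro _ ⟨y, rfl⟩
  have hcl : ∀ k, IsClosed (f k ⁻¹' {g k y}) := fun k => ((hf k).isClopen_fiber _).isClosed
  obtain ⟨x, hx⟩ := IsCompact.nonempty_iInter_of_sequence_nonempty_isCompact_isClosed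
    (fun k => f k ⁻¹' {g k y})
    (fun k x hx => by
      simp only [mem_preimage, mem_singleton_iff] at hx ⊢
      rw [← hft, hx, hgt])
    (fun k => hne k y) (hcl 0).isCompact hcl
  exact ⟨x, funext fun k => mem_iInter.1 hx k⟩

theorem isClosedEmbedding_of_separating {X : Type*} [TopologicalSpace X] [CompactSpace X]
    [T2Space X] [TotallyDisconnectedSpace X] {f : ℕ → X → ℕ} (hf : ∀ k, IsLocallyConstant (f k))
    (hsep : ∀ A : Set X, IsClopen A → ∃ k, ∃ s : Set ℕ, A = f k ⁻¹' s) :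
    IsClosedEmbedding (fun x k => f k x) := by
  refine (continuous_pi fun k => (hf k).continuous).isClosedEmbedding fun x y hxy => ?_
  by_contra hne
  obtain ⟨U, hU, hxU, hyU⟩ := exists_isClopen_of_totally_separated hne
  obtain ⟨k, s, rfl⟩ := hsep U hU
  apply hyU
  rw [mem_preimage] at hxU ⊢
  have hk : f k x = f k y := congrFun hxy k
  rwa [← hk]

theorem exists_seq_clopens (X : Type*) [TopologicalSpace X] [CompactSpace X] [T2Space X]
    [TotallyDisconnectedSpace X] [SecondCountableTopology X] :
    ∃ A : ℕ → Set X, (∀ k, IsClopen (A k)) ∧ ∀ U, IsClopen U → ∃ k, A k = U := by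
  have := TopologicalSpace.Clopens.countable_iff_secondCountable.2 ‹SecondCountableTopology X›
  obtain ⟨e, he⟩ := exists_surjective_nat (TopologicalSpace.Clopens X)
  refine ⟨fun k => e k, fun k => (e k).isClopen, fun U hU => ?_⟩
  obtain ⟨k, hk⟩ := he ⟨U, hU⟩
  exact ⟨k, congrArg (fun V : TopologicalSpace.Clopens X => (V : Set X)) hk⟩

/-- Vaught's criterion: a back-and-forth system of clopen sets gives a homeomorphism. -/
theorem nonempty_homeomorph_of_backAndForth {X Y : Type*}
    [TopologicalSpace X] [CompactSpace X] [T2Space X] [TotallyDisconnectedSpace X]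
    [SecondCountableTopology X] [TopologicalSpace Y] [CompactSpace Y] [T2Space Y]
    [TotallyDisconnectedSpace Y] [SecondCountableTopology Y] (R : Set X → Set Y → Prop)
    (huniv : R univ univ) (hempty : R ∅ ∅)
    (hne : ∀ A B, R A B → (A.Nonempty ↔ B.Nonempty))
    (forth : ∀ A B A', IsClopen A → IsClopen B → IsClopen A' → A' ⊆ A → R A B →
      ∃ B' ⊆ B, IsClopen B' ∧ R A' B' ∧ R (A \ A') (B \ B'))
    (back : ∀ B A B', IsClopen B → IsClopen A → IsClopen B' → B' ⊆ B → R A B →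
      ∃ A' ⊆ A, IsClopen A' ∧ R A' B' ∧ R (A \ A') (B \ B')) :
    Nonempty (X ≃ₜ Y) := by
  obtain ⟨A, hA, hA'⟩ := exists_seq_clopens X
  obtain ⟨B, hB, hB'⟩ := exists_seq_clopens Y
  -- One round splits along `A k` and then along `B k`, adding two binary digits; hence the division
  -- by `4`.
  have step : ∀ (k : ℕ) (P : ClopenMatching R), ∃ Q : ClopenMatching R,
      (∀ x, Q.left x / 4 = P.left x) ∧ (∀ y, Q.right y / 4 = P.right y) ∧
      (∀ x, Q.left x / 2 % 2 = 1 ↔ x ∈ A k) ∧ (∀ y, Q.right y % 2 = 1 ↔ y ∈ B k) := by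
    intro k P
    obtain ⟨Q₁, h1, h2, h3⟩ := P.exists_refine_left forth (hA k)
    obtain ⟨Q₂, h4, h5, h6⟩ := Q₁.swap.exists_refine_left back (hB k)
    refine ⟨Q₂.swap, fun x => ?_, fun y => ?_, fun x => ?_, h6⟩
    · rw [← h1, show Q₁.left x = Q₂.right x / 2 from (h5 x).symm, Nat.div_div_eq_div_mul]; rfl
    · rw [← h2, show Q₁.right y = Q₂.left y / 2 from (h4 y).symm, Nat.div_div_eq_div_mul]; rfl
    · rw [← h3, show Q₁.left x = Q₂.right x / 2 from (h5 x).symm]; rfl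
  choose next hn1 hn2 hn3 hn4 using step
  let P₀ : ClopenMatching R := ⟨fun _ => 0, fun _ => 0, IsLocallyConstant.const 0,
    IsLocallyConstant.const 0, fun i => by
      by_cases hi : 0 = i
      · rwa [preimage_const_of_mem (by exact hi), preimage_const_of_mem (by exact hi)]
      · rwa [preimage_const_of_notMem (by exact hi), preimage_const_of_notMem (by exact hi)]⟩
  let P : ℕ → ClopenMatching R := fun k => Nat.rec P₀ next k
  have hP : ∀ k, P (k + 1) = next k (P k) := fun k => rfl
  have hl : ∀ k x, (P (k + 1)).left x / 4 = (P k).left x := fun k x => by rw [hP, hn1]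
  have hr : ∀ k y, (P (k + 1)).right y / 4 = (P k).right y := fun k y => by rw [hP, hn2]
  have hX := isClosedEmbedding_of_separating (f := fun k => (P k).left)
    (fun k => (P k).left_locallyConstant) (fun U hU => by
      obtain ⟨k, rfl⟩ := hA' U hU
      exact ⟨k + 1, {c | c / 2 % 2 = 1}, by ext x; rw [← hn3 k (P k)]; rfl⟩)
  have hY := isClosedEmbedding_of_separating (f := fun k => (P k).right)
    (fun k => (P k).right_locallyConstant) (fun U hU => by
      obtain ⟨k, rfl⟩ := hB' U hU
      exact ⟨k + 1, {c | c % 2 = 1}, by ext x; rw [← hn4 k (P k)]; rfl⟩)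
  -- The digit sequences embed `X` and `Y` in the same sequence space; equal ranges yield the
  -- homeomorphism.
  have hrange : range (fun x k => (P k).left x) = range (fun y k => (P k).right y) := by
    apply Subset.antisymm
    · exact range_subset_range_of_compatible (f := fun k => (P k).right)
        (g := fun k => (P k).left) (t := fun c => c / 4) (fun k => (P k).right_locallyConstant)
        hr hl fun k x => (hne _ _ ((P k).rel ((P k).left x))).1 ⟨x, rfl⟩
    · exact range_subset_range_of_compatible (f := fun k => (P k).left)
        (g := fun k => (P k).right) (t := fun c => c / 4) (fun k => (P k).left_locallyConstant)
        hl hr fun k y => (hne _ _ ((P k).rel ((P k).right y))).2 ⟨y, rfl⟩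
  exact ⟨(hX.toIsEmbedding.toHomeomorph.trans (Homeomorph.setCongr hrange)).trans
    hY.toIsEmbedding.toHomeomorph.symm⟩

/-! ### The Mazurkiewicz-Sierpiński theorem -/

theorem exists_isClopen_inter_eq {Y : Type*} [TopologicalSpace Y] [CompactSpace Y] [T2Space Y]
    [TotallyDisconnectedSpace Y] {B S T : Set Y} (hB : IsClopen B) (hT : T.Finite) (hTB : T ⊆ B)
    (hST : S ⊆ T) : ∃ C ⊆ B, IsClopen C ∧ C ∩ T = S := by
  obtain ⟨C, hC, hSC, hCU⟩ := exists_clopen_of_closed_subset_open (hT.subset hST).isClosed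
    (hB.isOpen.inter (hT.subset (sdiff_subset (t := S))).isClosed.isOpen_compl)
    (fun y hy => ⟨hTB (hST hy), fun h => h.2 hy⟩)
  refine ⟨C, fun y hy => (hCU hy).1, hC, Subset.antisymm (fun y hy => ?_)
    fun y hy => ⟨hSC hy, hST hy⟩⟩
  by_contra hyS
  exact (hCU hy.1).2 ⟨hy.2, hyS⟩

namespace IsCBRank

variable {X Y : Type*} {r : X → Ordinal.{w}}
  {s : Y → Ordinal.{w}}

/-- Two sets have the same Cantor-Bendixson type if they are both empty or have the same maximal
rank, attained equally often. -/
def SameType (r : X → Ordinal.{w}) (s : Y → Ordinal.{w}) (A : Set X) (B : Set Y) : Prop :=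
  (A = ∅ ∧ B = ∅) ∨ ∃ γ : Ordinal.{w}, (∀ x ∈ A, r x ≤ γ) ∧ (∀ y ∈ B, s y ≤ γ) ∧
    (A ∩ r ⁻¹' {γ}).Nonempty ∧ (A ∩ r ⁻¹' {γ}).encard = (B ∩ s ⁻¹' {γ}).encard

theorem SameType.symm {A : Set X} {B : Set Y} (h : SameType r s A B) : SameType s r B A := by
  rcases h with ⟨h1, h2⟩ | ⟨γ, h1, h2, h3, h4⟩
  · exact Or.inl ⟨h2, h1⟩
  · refine Or.inr ⟨γ, h2, h1, ?_, h4.symm⟩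
    rwa [← encard_ne_zero, ← h4, encard_ne_zero]

theorem SameType.nonempty {A : Set X} {B : Set Y} (h : SameType r s A B) (hA : A.Nonempty) :
    B.Nonempty := by
  rcases h.symm with ⟨-, h⟩ | ⟨γ, -, -, h, -⟩
  · exact absurd h hA.ne_empty
  · exact h.mono inter_subset_left

variable [TopologicalSpace X] [TopologicalSpace Y]

theorem exists_isClopen_encard_eq [CompactSpace Y] [T2Space Y] (hs : IsCBRank s) {U : Set Y}
    (hU : IsOpen U) {y : Y} (hy : y ∈ U) {γ : Ordinal} (hγ : γ < s y) (k : ℕ∞) (hk : k ≠ ⊤) :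
    ∃ C ⊆ U, IsClopen C ∧ (∀ z ∈ C, s z ≤ γ) ∧ (C ∩ s ⁻¹' {γ}).encard = k := by
  have := hs.totallyDisconnectedSpace
  obtain ⟨S, hSU, hS⟩ := exists_subset_encard_eq (s := U ∩ s ⁻¹' {γ}) (k := k)
    (by rw [(hs.infinite_eq hU hy hγ).encard_eq]; exact le_top)
  have hSfin : S.Finite := finite_of_encard_eq_coe (k := k.toNat) (by rw [hS, ENat.natCast_toNat hk])
  -- Around a point of rank at most `γ` all other ranks are below `γ`, so the set stays open when
  -- only the top points in `S` are kept.
  have hV : IsOpen (U ∩ {z | s z < γ ∨ z ∈ S}) := by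
    rw [isOpen_iff_mem_nhds]
    rintro z ⟨hzU, hz⟩
    refine inter_mem (hU.mem_nhds hzU) ?_
    filter_upwards [hs.eventually_ne_imp_lt z] with w hw
    by_cases hwz : w = z
    · rwa [hwz]
    · refine Or.inl ((hw hwz).trans_le ?_)
      rcases hz with hz | hz
      · exact hz.le
      · exact (hSU hz).2.le
  obtain ⟨C, hC, hSC, hCV⟩ := exists_clopen_of_closed_subset_open hSfin.isClosed hV
    (fun z hz => ⟨(hSU hz).1, Or.inr hz⟩)
  refine ⟨C, fun z hz => (hCV hz).1, hC, fun z hz => ?_, ?_⟩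
  · rcases (hCV hz).2 with h | h
    · exact h.le
    · exact (hSU h).2.le
  · rw [← hS]
    congr 1
    refine Subset.antisymm (fun z hz => ?_) fun z hz => ⟨hSC hz, (hSU hz).2⟩
    rcases (hCV hz.1).2 with h | h
    · exact absurd hz.2 h.ne
    · exact h

/-- Cutting out a piece of rank below `γ` leaves the type unchanged, and a point of rank `γ` has
room nearby for a copy of every lower type. -/
theorem exists_sameType_of_lower [CompactSpace X] [CompactSpace Y] [T2Space Y]
    (hr : IsCBRank r) (hs : IsCBRank s) {A A₁ : Set X} {B : Set Y} (hB : IsClopen B)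
    (hA₁ : IsClopen A₁) {γ : Ordinal} (hAγ : ∀ x ∈ A, r x ≤ γ)
    (hBγ : ∀ y ∈ B, s y ≤ γ) (hne : (A ∩ r ⁻¹' {γ}).Nonempty)
    (hcard : (A ∩ r ⁻¹' {γ}).encard = (B ∩ s ⁻¹' {γ}).encard) (hlow : ∀ x ∈ A₁, r x < γ) :
    ∃ B₁ ⊆ B, IsClopen B₁ ∧ SameType r s A₁ B₁ ∧ SameType r s (A \ A₁) (B \ B₁) := by
  rcases A₁.eq_empty_or_nonempty with rfl | hA₁ne
  · exact ⟨∅, empty_subset _, isClopen_empty, Or.inl ⟨rfl, rfl⟩,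
      Or.inr ⟨γ, by simpa using hAγ, by simpa using hBγ, by simpa using hne, by simpa using hcard⟩⟩
  obtain ⟨x, hx, hmax⟩ := hr.exists_mem_isMax hA₁.isClosed.isCompact hA₁ne
  have hBne : (B ∩ s ⁻¹' {γ}).Nonempty := by rwa [← encard_ne_zero, ← hcard, encard_ne_zero]
  obtain ⟨b, hbB, hb⟩ := hBne
  obtain ⟨C, hCB, hC, hCle, hCcard⟩ := hs.exists_isClopen_encard_eq hB.isOpen hbB
    (γ := r x) (by rw [show s b = γ from hb]; exact hlow x hx) (A₁ ∩ r ⁻¹' {r x}).encard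
    (by rw [Ne, encard_eq_top_iff, not_infinite]; exact hr.finite_top hA₁.isClosed.isCompact hmax)
  have e1 : (A \ A₁) ∩ r ⁻¹' {γ} = A ∩ r ⁻¹' {γ} := by
    ext z
    refine ⟨fun h => ⟨h.1.1, h.2⟩, fun h => ⟨⟨h.1, fun h' => (hlow z h').ne h.2⟩, h.2⟩⟩
  have e2 : (B \ C) ∩ s ⁻¹' {γ} = B ∩ s ⁻¹' {γ} := by
    ext z
    refine ⟨fun h => ⟨h.1.1, h.2⟩, fun h => ⟨⟨h.1, fun h' => ?_⟩, h.2⟩⟩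
    exact ((hCle z h').trans_lt (hlow x hx)).ne h.2
  exact ⟨C, hCB, hC, Or.inr ⟨r x, hmax, hCle, ⟨x, hx, rfl⟩, hCcard.symm⟩,
    Or.inr ⟨γ, fun z hz => hAγ z hz.1, fun z hz => hBγ z hz.1, by rwa [e1], by rw [e1, e2, hcard]⟩⟩

theorem SameType.forth [CompactSpace X] [CompactSpace Y] [T2Space Y]
    (hr : IsCBRank r) (hs : IsCBRank s) (A : Set X) (B : Set Y) (A' : Set X) (hA : IsClopen A)
    (hB : IsClopen B) (hA' : IsClopen A') (hA'A : A' ⊆ A) (h : SameType r s A B) :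
    ∃ B' ⊆ B, IsClopen B' ∧ SameType r s A' B' ∧ SameType r s (A \ A') (B \ B') := by
  rcases h with ⟨rfl, rfl⟩ | ⟨γ, hAγ, hBγ, hne, hcard⟩
  · obtain rfl := subset_empty_iff.1 hA'A
    exact ⟨∅, empty_subset _, isClopen_empty, Or.inl ⟨rfl, rfl⟩, Or.inl (by simp)⟩
  by_cases h1 : (A' ∩ r ⁻¹' {γ}).Nonempty
  swap
  · exact exists_sameType_of_lower hr hs hB hA' hAγ hBγ hne hcard fun x hx =>
      (hAγ x (hA'A hx)).lt_of_ne fun h => h1 ⟨x, hx, h⟩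
  by_cases h2 : ((A \ A') ∩ r ⁻¹' {γ}).Nonempty
  swap
  · obtain ⟨B₁, hB₁, hB₁c, h3, h4⟩ := exists_sameType_of_lower hr hs hB (hA.diff hA') hAγ hBγ hne
      hcard fun x hx => (hAγ x hx.1).lt_of_ne fun h => h2 ⟨x, hx, h⟩
    rw [sdiff_sdiff_cancel_left hA'A] at h4
    exact ⟨B \ B₁, sdiff_subset, hB.diff hB₁c, h4, by rwa [sdiff_sdiff_cancel_left hB₁]⟩
  -- Both halves of `A` now contain top points. These are finite in number, so it suffices to split
  -- the top points of `B` in the same proportion.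
  have := hs.totallyDisconnectedSpace
  have hTA := hr.finite_top hA.isClosed.isCompact hAγ
  have hTB := hs.finite_top hB.isClosed.isCompact hBγ
  obtain ⟨S, hST, hS⟩ := exists_subset_encard_eq (s := B ∩ s ⁻¹' {γ})
    (k := (A' ∩ r ⁻¹' {γ}).encard)
    (by rw [← hcard]; exact encard_le_encard (inter_subset_inter_left _ hA'A))
  obtain ⟨C, hCB, hC, hCS⟩ := exists_isClopen_inter_eq hB hTB inter_subset_left hST
  have e1 : C ∩ s ⁻¹' {γ} = S := by
    rw [← hCS, ← inter_assoc, inter_eq_self_of_subset_left hCB]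
  have e2 : (B \ C) ∩ s ⁻¹' {γ} = (B ∩ s ⁻¹' {γ}) \ S := by
    rw [← e1]
    ext z
    simp only [mem_inter_iff, Set.mem_sdiff]
    tauto
  have e3 : (A \ A') ∩ r ⁻¹' {γ} = (A ∩ r ⁻¹' {γ}) \ (A' ∩ r ⁻¹' {γ}) := by
    ext z
    simp only [mem_inter_iff, Set.mem_sdiff]
    tauto
  refine ⟨C, hCB, hC, Or.inr ⟨γ, fun z hz => hAγ z (hA'A hz), fun z hz => hBγ z (hCB hz), h1, ?_⟩,
    Or.inr ⟨γ, fun z hz => hAγ z hz.1, fun z hz => hBγ z hz.1, h2, ?_⟩⟩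
  · rw [e1, hS]
  · rw [e2, e3]
    have h3 := encard_sdiff_add_encard_of_subset hST
    have h4 := encard_sdiff_add_encard_of_subset (inter_subset_inter_left (r ⁻¹' {γ}) hA'A)
    rw [hS, ← hcard, ← h4] at h3
    exact ((WithTop.add_right_inj (encard_ne_top_iff.2 (hTA.subset
      (inter_subset_inter_left _ hA'A)))).1 h3).symm

/-- The **Mazurkiewicz-Sierpiński theorem**. -/
theorem nonempty_homeomorph [CompactSpace X] [T2Space X] [SecondCountableTopology X]
    [CompactSpace Y] [T2Space Y] [SecondCountableTopology Y] (hr : IsCBRank r) (hs : IsCBRank s)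
    (h : SameType r s univ univ) : Nonempty (X ≃ₜ Y) := by
  have := hr.totallyDisconnectedSpace
  have := hs.totallyDisconnectedSpace
  refine nonempty_homeomorph_of_backAndForth (SameType r s) h (Or.inl ⟨rfl, rfl⟩)
    (fun A B h => ⟨h.nonempty, h.symm.nonempty⟩) (SameType.forth hr hs) ?_
  intro B A B' hB hA hB' hB'B h
  obtain ⟨A', h1, h2, h3, h4⟩ := SameType.forth hs hr B A B' hB hA hB' hB'B h.symm
  exact ⟨A', h1, h2, h3.symm, h4.symm⟩

end IsCBRank

/-- The first derived set missing a point has successor index, since limit stages are intersections;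
the predecessor is the rank. -/
theorem CantorBendixson.exists_isCBRank {X : Type u} [TopologicalSpace X] {α : Ordinal.{u}}
    (h : iteratedDerivedSet (univ : Set X) (α + 1) = ∅) :
    ∃ r : X → Ordinal.{u}, IsCBRank r ∧
      ∀ x γ, x ∈ iteratedDerivedSet (univ : Set X) γ ↔ γ ≤ r x := by
  have key : ∀ x : X, ∃ ρ : Ordinal.{u}, ∀ γ, x ∈ iteratedDerivedSet (univ : Set X) γ ↔ γ ≤ ρ := by
    intro x
    obtain ⟨δ, hδ, hmin⟩ := WellFounded.has_min Ordinal.lt_wf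
      {δ : Ordinal.{u} | x ∉ iteratedDerivedSet (univ : Set X) δ} ⟨α + 1, by simp [h]⟩
    have hmin' : ∀ γ < δ, x ∈ iteratedDerivedSet (univ : Set X) γ := fun γ hγ =>
      not_not.1 fun hx => hmin γ hx hγ
    rcases Ordinal.zero_or_succ_or_isSuccLimit δ with rfl | ⟨ρ, rfl⟩ | hlim
    · exact absurd (by simp) hδ
    · refine ⟨ρ, fun γ => ⟨fun hx => ?_, fun hγ => hmin' γ (Order.lt_succ_of_le hγ)⟩⟩
      by_contra! hlt
      exact hδ (iteratedDerivedSet_antitone _ (Order.succ_le_of_lt hlt) hx)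
    · refine absurd (show x ∈ iteratedDerivedSet univ δ from ?_) hδ
      rw [iteratedDerivedSet_limit hlim, mem_iInter]
      exact fun γ => hmin' γ γ.2
  choose r hr using key
  refine ⟨r, ⟨fun x => ?_, fun x γ hγ => ?_⟩, hr⟩
  · have h1 : x ∉ iteratedDerivedSet (univ : Set X) (r x + 1) := by
      rw [hr, not_le, ← Order.succ_eq_add_one]; exact Order.lt_succ _
    have h2 : x ∈ iteratedDerivedSet (univ : Set X) (r x) := (hr x _).2 le_rfl
    rw [iteratedDerivedSet_succ, relDerivedSet_apply] at h1
    have h3 : ¬ AccPt x (𝓟 (iteratedDerivedSet (univ : Set X) (r x))) := fun h => h1 ⟨h, h2⟩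
    rw [accPt_iff_frequently_nhdsNE, not_frequently] at h3
    filter_upwards [h3] with y hy
    rwa [hr, not_le] at hy
  · have h1 : x ∈ iteratedDerivedSet (univ : Set X) (γ + 1) :=
      (hr x _).2 (Order.succ_le_of_lt hγ)
    rw [iteratedDerivedSet_succ, relDerivedSet_apply] at h1
    have h2 := h1.1
    rw [mem_derivedSet, accPt_iff_frequently_nhdsNE] at h2
    exact h2.mono fun y hy => (hr y γ).1 hy

/-! ### Limit degree: no expansiveness -/

/-- Near a compact space's points of maximal rank, points of large rank never escape. -/
theorem IsCBRank.not_isNExpansive_of_isSuccLimit {X : Type*} [MetricSpace X] [CompactSpace X]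
    {r : X → Ordinal} (hr : IsCBRank r) {α : Ordinal} (hα : Order.IsSuccLimit α)
    (hle : ∀ x, r x ≤ α) {p : X} (hp : r p = α) (T : X ≃ₜ X) (m : ℕ) : ¬ IsNExpansive m T := by
  rintro ⟨δ, hδ, hm⟩
  have hfin : (univ ∩ r ⁻¹' {α}).Finite := hr.finite_top isCompact_univ fun x _ => hle x
  rw [univ_inter] at hfin
  have hinv : ∀ (k : ℤ) x, r ((T ^ k) x) = r x := fun k x => hr.homeomorph_apply _ x
  have hiso : ∀ q, r q = α → ∀ᶠ ε in 𝓝[>] (0 : ℝ), ∀ y, dist y q ≤ ε → r y = α → y = q := by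
    intro q hq
    obtain ⟨ε, hε, hball⟩ := Metric.eventually_nhds_iff.1 (hr.eventually_ne_imp_lt q)
    filter_upwards [Ioo_mem_nhdsGT hε] with ε' hε' y hy hyα
    by_contra hne
    exact (hball (hy.trans_lt hε'.2) hne).ne (hyα.trans hq.symm)
  obtain ⟨ε, hεtop, hε0, hεδ⟩ := (((eventually_all_finite hfin).2 hiso).and
    (Ioo_mem_nhdsGT hδ)).exists
  -- Points that escape in one step, forwards or backwards, from the `ε`-ball of a top point.
  let bad : Set X := ⋃ q ∈ r ⁻¹' {α}, ⋃ S ∈ ({T, T⁻¹} : Set (X ≃ₜ X)),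
    Metric.closedBall q ε ∩ {x | ε ≤ dist (S x) (S q)}
  have hbad : IsCompact bad := by
    refine hfin.isCompact_biUnion fun q _ => (toFinite _).isCompact_biUnion fun S _ => ?_
    exact (Metric.isClosed_closedBall.inter
      (isClosed_le continuous_const (S.continuous.dist continuous_const))).isCompact
  have hbad_lt : ∀ x ∈ bad, r x < α := by
    intro x hx
    simp only [bad, mem_iUnion] at hx
    obtain ⟨q, hq, S, -, hxq, hx⟩ := hx
    refine (hle x).lt_of_ne fun hxα => ?_
    rw [hεtop q hq x hxq hxα, mem_ofPred_eq, dist_self] at hx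
    exact hε0.not_ge hx
  obtain ⟨β, hβ, hbadβ⟩ : ∃ β < α, ∀ x ∈ bad, r x < β := by
    rcases bad.eq_empty_or_nonempty with he | hne
    · exact ⟨0, hα.bot_lt, by simp [he]⟩
    · obtain ⟨x, hx, hmax⟩ := hr.exists_mem_isMax hbad hne
      exact ⟨Order.succ (r x), hα.succ_lt (hbad_lt x hx), fun y hy => Order.lt_succ_of_le (hmax y hy)⟩
  have hstep : ∀ S ∈ ({T, T⁻¹} : Set (X ≃ₜ X)), ∀ q, r q = α → ∀ x, β ≤ r x → dist x q ≤ ε →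
      dist (S x) (S q) ≤ ε := by
    intro S hS q hq x hx hxq
    by_contra! hlt
    refine (hbadβ x ?_).not_ge hx
    simp only [bad, mem_iUnion]
    exact ⟨q, hq, S, hS, hxq, hlt.le⟩
  have hsub : {x | β ≤ r x} ∩ Metric.closedBall p ε ⊆ dynamicalBall T δ p := by
    rintro x ⟨hx, hxp⟩ k
    rw [dist_comm]
    refine le_trans ?_ hεδ.le
    induction k using Int.induction_on with
    | zero => simpa using hxp
    | succ i ih =>
      rw [add_comm, zpow_add, zpow_one]
      exact hstep T (by simp) _ ((hinv _ _).trans hp) _ (hx.trans_eq (hinv _ _).symm) ih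
    | pred i ih =>
      rw [sub_eq_add_neg, add_comm, zpow_add, zpow_neg_one]
      exact hstep T⁻¹ (by simp) _ ((hinv _ _).trans hp) _ (hx.trans_eq (hinv _ _).symm) ih
  have hinf : (dynamicalBall T δ p).Infinite := by
    refine (hr.infinite_eq Metric.isOpen_ball (Metric.mem_ball_self hε0)
      (hβ.trans_eq hp.symm)).mono fun x hx => hsub ⟨hx.2.ge, Metric.ball_subset_closedBall hx.1⟩
  have := hm p
  rw [hinf.encard_eq] at this
  exact absurd this (by simp)

/-! ### The shift space of a block code -/

/-- Parity. It shows that two marks `t` and `t + 3 ^ i` force `t` to be the initial mark. -/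
theorem three_pow_add_three_pow_ne (i j l : ℕ) : (3 : ℤ) ^ i + 3 ^ j ≠ 3 ^ l := by
  intro h
  have hodd : ∀ m : ℕ, Odd ((3 : ℤ) ^ m) := fun m => Odd.pow (by decide)
  have h1 := (hodd i).add_odd (hodd j)
  rw [h] at h1
  exact (Int.not_even_iff_odd.2 (hodd l)) h1

/-- Gaps between distinct powers of `3` are at least two thirds of the larger one. Thus, seen from a
far mark `3 ^ i`, all other marks recede to infinity. -/
theorem eventually_three_pow_sub_three_pow (d : ℤ) (hd : d ≠ 0) :
    ∀ᶠ i : ℕ in atTop, ∀ j : ℕ, d ≠ 3 ^ j - 3 ^ i := by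
  filter_upwards [eventually_ge_atTop (3 * d.natAbs + 1)] with i hi j hj
  have hlt : ∀ a : ℕ, (a : ℤ) < 3 ^ a := fun a => by exact_mod_cast Nat.lt_pow_self (by norm_num)
  have hpos : ∀ a : ℕ, (0 : ℤ) < 3 ^ a := fun a => by positivity
  have hi' : 3 * |d| + 1 ≤ (i : ℤ) := by rw [Int.abs_eq_natAbs]; exact_mod_cast hi
  have hd1 := le_abs_self d
  have hd2 := neg_abs_le d
  have hli := hlt i
  rcases lt_trichotomy j i with h | h | h
  · have h1 : (3 : ℤ) ^ (j + 1) ≤ 3 ^ i := pow_le_pow_right₀ (by norm_num) h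
    rw [pow_succ] at h1
    have := hpos j
    omega
  · subst h; omega
  · have h1 : (3 : ℤ) ^ (i + 1) ≤ 3 ^ j := pow_le_pow_right₀ (by norm_num) h
    rw [pow_succ] at h1
    omega

/-- A pointed space together with a sequence of clopen sets avoiding the base point. -/
structure BlockCode (Y : Type*) [TopologicalSpace Y] where
  base : Y
  block : ℕ → Set Y
  isClopen_block : ∀ i, IsClopen (block i)
  base_notMem_block : ∀ i, base ∉ block i

namespace BlockCode

/-- The points of the subshift attached to a block code: a fixed point `none`, and the
translates `some (t, y)` of a bi-infinite sequence describing `y`. -/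
def Subshift {Y : Type*} [TopologicalSpace Y] (_ : BlockCode Y) := Option (ℤ × Y)

variable {Y : Type*} [UniformSpace Y] (D : BlockCode Y)

/-- The translate by `t` of the sequence describing `y`. -/
def pt (t : ℤ) (y : Y) : D.Subshift := some (t, y)

/-- The fixed point of the subshift. -/
def infty : D.Subshift := none

/-- The sequence attached to `y` and `t` is marked at `t` and at those `t + 3 ^ i` for which `y`
lies in the `i`-th block. -/
def Marked : D.Subshift → ℤ → Prop
  | none, _ => False
  | some (t, y), s => s = t ∨ ∃ i : ℕ, s = t + 3 ^ i ∧ y ∈ D.block i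

open Classical in
/-- The sequence attached to `y` and `t` has the letter `y` at position `t`. -/
noncomputable def letter : D.Subshift → ℤ → Y
  | none, _ => D.base
  | some (t, y), s => if s = t then y else D.base

open Classical in
/-- A point of the subshift as a sequence of marks and letters. -/
noncomputable def code (x : D.Subshift) (s : ℤ) : Bool × Y := (decide (D.Marked x s), D.letter x s)

noncomputable instance : UniformSpace D.Subshift := UniformSpace.comap D.code inferInstance

variable {D}

theorem cases_pt (x : D.Subshift) : x = D.infty ∨ ∃ t y, x = D.pt t y := by
  rcases x with _ | ⟨t, y⟩
  · exact Or.inl rfl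
  · exact Or.inr ⟨t, y, rfl⟩

@[simp] theorem marked_infty (s : ℤ) : ¬ D.Marked D.infty s := id

theorem marked_pt {t s : ℤ} {y : Y} :
    D.Marked (D.pt t y) s ↔ s = t ∨ ∃ i : ℕ, s = t + 3 ^ i ∧ y ∈ D.block i := Iff.rfl

theorem marked_self (t : ℤ) (y : Y) : D.Marked (D.pt t y) t := Or.inl rfl

theorem le_of_marked {t s : ℤ} {y : Y} (h : D.Marked (D.pt t y) s) : t ≤ s := by
  rcases h with rfl | ⟨i, rfl, -⟩
  · exact le_rfl
  · have : (0 : ℤ) < 3 ^ i := by positivity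
    omega

theorem marked_add_three_pow {t : ℤ} {y : Y} {i : ℕ} :
    D.Marked (D.pt t y) (t + 3 ^ i) ↔ y ∈ D.block i := by
  constructor
  · rintro (h | ⟨j, h, hj⟩)
    · have : (0 : ℤ) < 3 ^ i := by positivity
      omega
    · have h1 : (3 : ℤ) ^ i = 3 ^ j := by omega
      rwa [Int.pow_right_injective (a := 3) (by decide) h1]
  · exact fun h => Or.inr ⟨i, rfl, h⟩

theorem marked_base {t s : ℤ} : D.Marked (D.pt t D.base) s ↔ s = t := by
  rw [marked_pt]
  exact or_iff_left fun ⟨i, _, h⟩ => D.base_notMem_block i h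

@[simp] theorem letter_infty (s : ℤ) : D.letter D.infty s = D.base := rfl

theorem letter_pt (t s : ℤ) (y : Y) : D.letter (D.pt t y) s = if s = t then y else D.base := by
  unfold letter pt
  congr

@[simp] theorem letter_self (t : ℤ) (y : Y) : D.letter (D.pt t y) t = y := by simp [letter_pt]

theorem letter_of_ne {t s : ℤ} (h : s ≠ t) (y : Y) : D.letter (D.pt t y) s = D.base := by
  simp [letter_pt, h]

@[simp] theorem letter_base (t s : ℤ) : D.letter (D.pt t D.base) s = D.base := by
  simp [letter_pt]

theorem pt_injective (t : ℤ) : Function.Injective (D.pt t) := by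
  intro y y' h
  rw [← letter_self (D := D) t y, h, letter_self]

theorem pt_ne_infty (t : ℤ) (y : Y) : D.pt t y ≠ D.infty := Option.some_ne_none _

theorem code_eq_code {x x' : D.Subshift} {s s' : ℤ} :
    D.code x s = D.code x' s' ↔
      (D.Marked x s ↔ D.Marked x' s') ∧ D.letter x s = D.letter x' s' := by
  simp [code]

theorem eq_of_marked_iff {t t' : ℤ} {y y' : Y}
    (h : ∀ s, D.Marked (D.pt t y) s ↔ D.Marked (D.pt t' y') s) : t = t' :=
  le_antisymm (le_of_marked ((h t').2 (marked_self _ _)))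
    (le_of_marked ((h t).1 (marked_self _ _)))

theorem code_injective : Function.Injective D.code := by
  intro x x' h
  have hm : ∀ s, D.Marked x s ↔ D.Marked x' s := fun s => (code_eq_code.1 (congrFun h s)).1
  have hl : ∀ s, D.letter x s = D.letter x' s := fun s => (code_eq_code.1 (congrFun h s)).2
  rcases cases_pt x with rfl | ⟨t, y, rfl⟩ <;> rcases cases_pt x' with rfl | ⟨t', y', rfl⟩
  · rfl
  · exact absurd ((hm t').2 (marked_self _ _)) (marked_infty _)
  · exact absurd ((hm t).1 (marked_self _ _)) (marked_infty _)
  · obtain rfl := eq_of_marked_iff hm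
    have := hl t
    rw [letter_self, letter_self] at this
    rw [this]

theorem isUniformInducing_code : IsUniformInducing D.code := ⟨rfl⟩

theorem isEmbedding_code : IsEmbedding D.code :=
  ⟨isUniformInducing_code.isInducing, code_injective⟩

instance [T2Space Y] : T2Space D.Subshift := isEmbedding_code.t2Space

instance [SecondCountableTopology Y] : SecondCountableTopology D.Subshift :=
  isEmbedding_code.secondCountableTopology

theorem uniformContinuous_code (s : ℤ) : UniformContinuous fun x : D.Subshift => D.code x s :=
  (Pi.uniformContinuous_proj _ s).comp isUniformInducing_code.uniformContinuous

theorem continuous_letter (s : ℤ) : Continuous fun x : D.Subshift => D.letter x s :=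
  continuous_snd.comp (uniformContinuous_code s).continuous

theorem isClopen_marked (s : ℤ) : IsClopen {x : D.Subshift | D.Marked x s} := by
  have : {x : D.Subshift | D.Marked x s} = (fun x => (D.code x s).1) ⁻¹' {true} := by
    ext x; simp [code]
  rw [this]
  exact (isClopen_discrete _).preimage (continuous_fst.comp (uniformContinuous_code s).continuous)

theorem tendsto_of_eventually_code_eq {ι : Type*} {l : Filter ι} {f : ι → D.Subshift}
    {x : D.Subshift} (h : ∀ s, ∀ᶠ i in l, D.code (f i) s = D.code x s) : Tendsto f l (𝓝 x) := by
  rw [isEmbedding_code.tendsto_nhds_iff, tendsto_pi_nhds]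
  exact fun s => tendsto_nhds_of_eventually_eq (h s)

theorem continuous_pt (t : ℤ) : Continuous (D.pt t) := by
  classical
  rw [isEmbedding_code.continuous_iff, continuous_pi_iff]
  intro s
  refine Continuous.prodMk ?_ ?_
  · rw [continuous_bool_rng true]
    have : (fun y => decide (D.Marked (D.pt t y) s)) ⁻¹' {true} =
        {y | s = t ∨ ∃ i : ℕ, s = t + 3 ^ i ∧ y ∈ D.block i} := by
      ext y; simp [marked_pt]
    rw [this]
    by_cases hst : s = t
    · simpa [hst] using isClopen_univ
    by_cases hi : ∃ i : ℕ, s = t + 3 ^ i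
    · obtain ⟨i, rfl⟩ := hi
      convert D.isClopen_block i using 1
      ext y
      exact marked_add_three_pow
    · push Not at hi
      simpa [hst, hi] using isClopen_empty
  · by_cases hst : s = t
    · subst hst; simpa using continuous_id'
    · simpa [letter_of_ne hst] using continuous_const

/-- Sequences seen from a late mark look like the sequence of the base point. -/
theorem eventually_pt_sub_three_pow_mem {t : ℤ} {U : Set D.Subshift} (hU : U ∈ 𝓝 (D.pt t D.base)) :
    ∀ᶠ i : ℕ in atTop, ∀ y ∈ D.block i, D.pt (t - 3 ^ i) y ∈ U := by
  have key : Tendsto (fun p : ℕ × Y => D.pt (t - 3 ^ p.1) p.2)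
      (comap Prod.fst atTop ⊓ 𝓟 {p | p.2 ∈ D.block p.1}) (𝓝 (D.pt t D.base)) := by
    refine tendsto_of_eventually_code_eq fun s => ?_
    rw [eventually_inf_principal]
    by_cases hs : s = t
    · subst hs
      refine Eventually.of_forall fun p hp => code_eq_code.2 ⟨?_, ?_⟩
      · simp only [marked_self, iff_true]
        exact Or.inr ⟨p.1, by ring, hp⟩
      · rw [letter_of_ne, letter_self]
        have : (0 : ℤ) < 3 ^ p.1 := by positivity
        omega
    · have h1 := (eventually_three_pow_sub_three_pow (s - t) (sub_ne_zero.2 hs)).and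
        ((tendsto_pow_atTop_atTop_of_one_lt (r := (3 : ℤ)) (by norm_num)).eventually
          (eventually_gt_atTop (t - s)))
      refine (tendsto_comap.eventually h1).mono fun p hp _ => code_eq_code.2 ?_
      have h2 : s ≠ t - 3 ^ p.1 := by have := hp.2; omega
      refine ⟨iff_of_false ?_ (fun h => hs (marked_base.1 h)), ?_⟩
      · rintro (h | ⟨j, h, -⟩)
        · exact h2 h
        · exact hp.1 j (by omega)
      · rw [letter_of_ne h2, letter_base]
  have h := key.eventually_mem hU
  rw [eventually_inf_principal, eventually_comap] at h
  filter_upwards [h] with i hi y hy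
  exact hi (i, y) rfl hy

theorem tendsto_pt_base_cofinite : Tendsto (fun t => D.pt t D.base) cofinite (𝓝 D.infty) := by
  refine tendsto_of_eventually_code_eq fun s => ?_
  filter_upwards [(finite_singleton s).eventually_cofinite_notMem] with t ht
  rw [code_eq_code, marked_base, letter_base, letter_infty]
  simpa [eq_comm] using ht

/-- The mark at `s` is either initial, or comes from one fixed block, or from blocks with index
tending to infinity; in the last case the limit is the base point's sequence started at `s`. -/
theorem isCompact_marked [CompactSpace Y] (s : ℤ) : IsCompact {x : D.Subshift | D.Marked x s} := by
  rw [isCompact_iff_ultrafilter_le_nhds]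
  intro F hF
  rw [le_principal_iff] at hF
  have him : ∀ (t : ℤ) (B : Set Y), IsClosed B → (∀ y ∈ B, D.Marked (D.pt t y) s) →
      D.pt t '' B ∈ F → ∃ x ∈ {x : D.Subshift | D.Marked x s}, ↑F ≤ 𝓝 x := by
    intro t B hB hm hBF
    obtain ⟨_, ⟨y, hy, rfl⟩, hx⟩ := isCompact_iff_ultrafilter_le_nhds.1
      (hB.isCompact.image (continuous_pt t)) F (le_principal_iff.2 hBF)
    exact ⟨_, hm y hy, hx⟩
  by_cases h0 : D.pt s '' univ ∈ F
  · exact him s univ isClosed_univ (fun y _ => marked_self _ _) h0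
  by_cases h1 : ∃ i : ℕ, D.pt (s - 3 ^ i) '' D.block i ∈ F
  · obtain ⟨i, hi⟩ := h1
    exact him _ _ (D.isClopen_block i).isClosed (fun y hy => Or.inr ⟨i, by ring, hy⟩) hi
  push Not at h1
  refine ⟨D.pt s D.base, marked_self _ _, fun U hU => ?_⟩
  obtain ⟨N, hN⟩ := eventually_atTop.1 (eventually_pt_sub_three_pow_mem hU)
  have h2 : (⋃ i ∈ Iio N, D.pt (s - 3 ^ i) '' D.block i) ∉ F := by
    rw [Ultrafilter.finite_biUnion_mem_iff (finite_Iio N)]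
    rintro ⟨i, -, hi⟩
    exact h1 i hi
  rw [← Ultrafilter.compl_mem_iff_notMem] at h0 h2
  filter_upwards [hF, h0, h2] with x hx hx0 hx2
  rcases cases_pt x with rfl | ⟨t, y, rfl⟩
  · exact absurd hx (marked_infty _)
  · rcases hx with rfl | ⟨i, rfl, hi⟩
    · exact absurd (mem_image_of_mem _ (mem_univ y)) hx0
    · have h3 := hN i
      rw [add_sub_cancel_right] at h3
      by_cases hiN : i < N
      · refine absurd ?_ hx2
        exact mem_biUnion (show i ∈ Iio N from hiN) ⟨y, hi, by rw [add_sub_cancel_right]⟩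
      · exact h3 (not_lt.1 hiN) y hi

instance [CompactSpace Y] : CompactSpace D.Subshift := by
  refine ⟨isCompact_iff_ultrafilter_le_nhds.2 fun F _ => ?_⟩
  by_cases h : ∃ s, {x : D.Subshift | D.Marked x s} ∈ F
  · obtain ⟨s, hs⟩ := h
    obtain ⟨x, -, hx⟩ := isCompact_iff_ultrafilter_le_nhds.1 (isCompact_marked s) F
      (le_principal_iff.2 hs)
    exact ⟨x, mem_univ _, hx⟩
  · push Not at h
    refine ⟨D.infty, mem_univ _, ?_⟩
    refine tendsto_id'.1 (tendsto_of_eventually_code_eq fun s => ?_)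
    have h1 := Ultrafilter.compl_mem_iff_notMem.2 (h s)
    filter_upwards [h1] with x hx
    refine code_eq_code.2 ⟨iff_of_false hx (marked_infty _), ?_⟩
    rcases cases_pt x with rfl | ⟨t, y, rfl⟩
    · rfl
    · refine letter_of_ne (fun hst => hx ?_) y
      rw [hst]
      exact marked_self _ _

/-- The rank on the subshift induced by a rank on `Y`. -/
def rank (r : Y → Ordinal.{w}) : D.Subshift → Ordinal.{w}
  | none => r D.base + 1
  | some (_, y) => r y

/-- Near a translate of `y ≠ base`, two marks pin down the translation, so the space looks like `Y`
near `y`. Near a translate of `base`, sequences with another initial mark may appear, but they come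
from points of blocks, which have smaller rank. -/
theorem isCBRank_rank {r : Y → Ordinal.{w}} (hr : IsCBRank r)
    (hlt : ∀ y, y ≠ D.base → r y < r D.base) (hcov : ∀ y, y ≠ D.base → ∃ i, y ∈ D.block i) :
    IsCBRank (D.rank r) := by
  have hle : ∀ y, r y ≤ r D.base := fun y => by
    by_cases h : y = D.base
    · rw [h]
    · exact (hlt y h).le
  constructor
  · intro x
    rcases cases_pt x with rfl | ⟨t, y, rfl⟩
    · filter_upwards [self_mem_nhdsWithin] with x hx
      rcases cases_pt x with rfl | ⟨t, y, rfl⟩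
      · exact absurd rfl hx
      · exact Order.lt_succ_of_le (hle y)
    have hmark : ∀ s, D.Marked (D.pt t y) s → ∀ᶠ x in 𝓝[≠] (D.pt t y), D.Marked x s := fun s hs =>
      eventually_nhdsWithin_of_eventually_nhds ((isClopen_marked s).isOpen.mem_nhds hs)
    by_cases hy : y = D.base
    · subst hy
      filter_upwards [hmark t (marked_self _ _), self_mem_nhdsWithin] with x hx hxne
      rcases cases_pt x with rfl | ⟨t', y', rfl⟩
      · exact absurd hx (marked_infty _)
      refine hlt y' ?_
      rcases hx with rfl | ⟨i, -, hi⟩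
      · rintro rfl
        exact hxne rfl
      · rintro rfl
        exact D.base_notMem_block i hi
    · obtain ⟨i, hi⟩ := hcov y hy
      have hlet := ((continuous_letter (D := D) t).tendsto' (D.pt t y) y (letter_self t y)).eventually
        (hr.eventually_ne_imp_lt y)
      filter_upwards [hmark t (marked_self _ _), hmark (t + 3 ^ i) (marked_add_three_pow.2 hi),
        eventually_nhdsWithin_of_eventually_nhds hlet, self_mem_nhdsWithin] with x h1 h2 h3 h4
      rcases cases_pt x with rfl | ⟨t', y', rfl⟩
      · exact absurd h1 (marked_infty _)
      have htt : t = t' := by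
        rcases h1 with h1 | ⟨j, h1, -⟩
        · exact h1
        · have hi0 : (0 : ℤ) < 3 ^ i := by positivity
          have hj0 : (0 : ℤ) < 3 ^ j := by positivity
          rcases h2 with h2 | ⟨l, h2, -⟩
          · omega
          · exact absurd (by omega) (three_pow_add_three_pow_ne j i l)
      subst htt
      rw [letter_self] at h3
      exact h3 fun h => h4 (by rw [h]; rfl)
  · intro x γ hγ
    rcases cases_pt x with rfl | ⟨t, y, rfl⟩
    · have h1 : Tendsto (fun t => D.pt t D.base) cofinite (𝓝[≠] D.infty) :=
        tendsto_nhdsWithin_of_tendsto_nhds_of_eventually_within _ tendsto_pt_base_cofinite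
          (Eventually.of_forall fun t => pt_ne_infty _ _)
      exact h1.frequently (Eventually.of_forall fun t => Order.le_of_lt_succ hγ).frequently
    · have h1 : Tendsto (D.pt t) (𝓝[≠] y) (𝓝[≠] (D.pt t y)) :=
        tendsto_nhdsWithin_of_tendsto_nhds_of_eventually_within _
          ((continuous_pt t).continuousAt.tendsto.mono_left nhdsWithin_le_nhds)
          (eventually_nhdsWithin_of_forall fun z hz h => hz (pt_injective t h))
      exact h1.frequently (hr.frequently_le y γ hγ)

end BlockCode

/-! ### Expansiveness in uniform spaces, conjugation and products -/

/-- The uniform-space version of `n`-expansiveness. -/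
def IsUniformlyNExpansive {X : Type*} [UniformSpace X] (n : ℕ) (T : X ≃ₜ X) : Prop :=
  ∃ V ∈ 𝓤 X, ∀ x, {y | ∀ k : ℤ, ((T ^ k) x, (T ^ k) y) ∈ V}.encard ≤ n

theorem isNExpansive_iff_isUniformlyNExpansive {X : Type*} [MetricSpace X] {n : ℕ} {T : X ≃ₜ X} :
    IsNExpansive n T ↔ IsUniformlyNExpansive n T := by
  constructor
  · rintro ⟨δ, hδ, h⟩
    exact ⟨{p | dist p.1 p.2 ≤ δ}, mem_of_superset (Metric.dist_mem_uniformity hδ)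
      fun p hp => show dist p.1 p.2 ≤ δ from le_of_lt hp, h⟩
  · rintro ⟨V, hV, h⟩
    obtain ⟨ε, hε, hεV⟩ := Metric.mem_uniformity_dist.1 hV
    refine ⟨ε / 2, half_pos hε, fun x => (encard_le_encard ?_).trans (h x)⟩
    exact fun y hy k => hεV ((hy k).trans_lt (half_lt_self hε))

/-- Expansiveness passes to subsystems. -/
theorem IsUniformlyNExpansive.of_semiconj {X Y : Type*} [UniformSpace X] [UniformSpace Y] {n : ℕ}
    {S : X ≃ₜ X} {T : Y ≃ₜ Y} (hT : IsUniformlyNExpansive n T) {f : X → Y}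
    (hf : UniformContinuous f) (hinj : Function.Injective f)
    (hST : ∀ (k : ℤ) x, f ((S ^ k) x) = (T ^ k) (f x)) : IsUniformlyNExpansive n S := by
  obtain ⟨V, hV, h⟩ := hT
  refine ⟨_, hf hV, fun x => le_trans ?_ (h (f x))⟩
  rw [← hinj.encard_image]
  refine encard_le_encard ?_
  rintro _ ⟨y, hy, rfl⟩ k
  have := hy k
  rwa [mem_preimage, hST, hST] at this

/-- Conjugation by a homeomorphism. -/
def Homeomorph.conjHom {X Y : Type*} [TopologicalSpace X] [TopologicalSpace Y] (e : X ≃ₜ Y) :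
    (Y ≃ₜ Y) →* (X ≃ₜ X) where
  toFun T := (e.trans T).trans e.symm
  map_one' := by ext x; simp
  map_mul' S T := by ext x; simp

theorem Homeomorph.apply_conjHom_zpow {X Y : Type*} [TopologicalSpace X] [TopologicalSpace Y]
    (e : X ≃ₜ Y) (T : Y ≃ₜ Y) (k : ℤ) (x : X) : e ((e.conjHom T ^ k) x) = (T ^ k) (e x) := by
  rw [← map_zpow]
  exact e.apply_symm_apply _

theorem isUniformlyNExpansive_conjHom_iff {X Y : Type*} [UniformSpace X] [UniformSpace Y]
    [CompactSpace X] [CompactSpace Y] {n : ℕ} (e : X ≃ₜ Y) (T : Y ≃ₜ Y) :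
    IsUniformlyNExpansive n (e.conjHom T) ↔ IsUniformlyNExpansive n T := by
  refine ⟨fun h => h.of_semiconj (CompactSpace.uniformContinuous_of_continuous e.symm.continuous)
      e.symm.injective fun k y => ?_,
    fun h => h.of_semiconj (CompactSpace.uniformContinuous_of_continuous e.continuous)
      e.injective (e.apply_conjHom_zpow T)⟩
  apply e.injective
  rw [e.apply_conjHom_zpow, e.apply_symm_apply, e.apply_symm_apply]

/-- The homeomorphism of a product acting on the second factor. -/
def Homeomorph.sndHom (ι : Type*) {X : Type*} [TopologicalSpace ι] [TopologicalSpace X] :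
    (X ≃ₜ X) →* (ι × X ≃ₜ ι × X) where
  toFun T := (Homeomorph.refl ι).prodCongr T
  map_one' := by ext x <;> simp
  map_mul' S T := by ext x <;> simp

theorem Homeomorph.sndHom_zpow_apply {ι X : Type*} [TopologicalSpace ι] [TopologicalSpace X]
    (T : X ≃ₜ X) (k : ℤ) (x : ι × X) : (sndHom ι T ^ k) x = (x.1, (T ^ k) x.2) := by
  rw [← map_zpow]
  rfl

theorem isUniformlyNExpansive_sndHom_iff {ι X : Type*} [UniformSpace ι] [DiscreteUniformity ι]
    [Nonempty ι] [UniformSpace X] {n : ℕ} (T : X ≃ₜ X) :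
    IsUniformlyNExpansive n (Homeomorph.sndHom ι T) ↔ IsUniformlyNExpansive n T := by
  constructor
  · intro h
    obtain ⟨i⟩ := ‹Nonempty ι›
    refine h.of_semiconj (f := Prod.mk i) (uniformContinuous_const.prodMk uniformContinuous_id)
      (Prod.mk_right_injective i) fun k x => ?_
    rw [Homeomorph.sndHom_zpow_apply]
  · rintro ⟨V, hV, h⟩
    refine ⟨{p | p.1.1 = p.2.1} ∩ {p | (p.1.2, p.2.2) ∈ V}, inter_mem ?_
      (uniformContinuous_snd hV), fun x => le_trans ?_ (h x.2)⟩
    · have h1 : UniformContinuous (Prod.fst : ι × X → ι) := uniformContinuous_fst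
      exact h1 (by rw [DiscreteUniformity.eq_principal_setRelId]; exact mem_principal_self _)
    · rw [← (Prod.mk_right_injective x.1).encard_image {y | ∀ k : ℤ, ((T ^ k) x.2, (T ^ k) y) ∈ V}]
      refine encard_le_encard fun y hy => ?_
      have h0 := (hy 0).1
      have h1 : x.1 = y.1 := h0
      refine ⟨y.2, fun k => ?_, by rw [h1]⟩
      have h2 := (hy k).2
      rwa [Homeomorph.sndHom_zpow_apply, Homeomorph.sndHom_zpow_apply] at h2

theorem IsCBRank.comp_snd {ι X : Type*} [TopologicalSpace ι] [DiscreteTopology ι]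
    [TopologicalSpace X] {r : X → Ordinal} (hr : IsCBRank r) :
    IsCBRank (fun p : ι × X => r p.2) := by
  have key : ∀ p : ι × X, 𝓝[≠] p = map (Prod.mk p.1) (𝓝[≠] p.2) := by
    rintro ⟨i, x⟩
    have h1 : 𝓝 (i, x) = map (Prod.mk i) (𝓝 x) := by
      rw [nhds_prod_eq, nhds_discrete, pure_prod]
    have h2 : ({x} : Set X)ᶜ = Prod.mk i ⁻¹' {(i, x)}ᶜ := by ext y; simp
    rw [nhdsWithin, h1, nhdsWithin, h2, ← comap_principal, Filter.push_pull]
  constructor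
  · intro p
    rw [key, eventually_map]
    exact hr.eventually_lt p.2
  · intro p γ hγ
    rw [key, frequently_map]
    exact hr.frequently_le p.2 γ hγ

/-! ### Expansiveness of the shift -/

namespace BlockCode

variable {Y : Type*} [UniformSpace Y] {D : BlockCode Y}

/-- Translation by `k`. -/
def translate (k : ℤ) : D.Subshift → D.Subshift
  | none => none
  | some (t, y) => some (t + k, y)

@[simp] theorem translate_pt (k t : ℤ) (y : Y) : translate k (D.pt t y) = D.pt (t + k) y := rfl

theorem translate_translate (k l : ℤ) (x : D.Subshift) :
    translate k (translate l x) = translate (k + l) x := by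
  rcases cases_pt x with rfl | ⟨t, y, rfl⟩
  · rfl
  · simp only [translate_pt, add_comm k l, add_assoc]

theorem translate_zero (x : D.Subshift) : translate 0 x = x := by
  rcases cases_pt x with rfl | ⟨t, y, rfl⟩
  · rfl
  · simp

theorem marked_translate {k s : ℤ} {x : D.Subshift} :
    D.Marked (translate k x) s ↔ D.Marked x (s - k) := by
  rcases cases_pt x with rfl | ⟨t, y, rfl⟩
  · rfl
  · simp only [translate_pt, marked_pt, sub_eq_iff_eq_add, add_right_comm]

theorem letter_translate {k s : ℤ} {x : D.Subshift} :
    D.letter (translate k x) s = D.letter x (s - k) := by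
  rcases cases_pt x with rfl | ⟨t, y, rfl⟩
  · rfl
  · simp only [translate_pt, letter_pt, sub_eq_iff_eq_add]

theorem continuous_translate (k : ℤ) : Continuous (translate k : D.Subshift → D.Subshift) := by
  rw [isEmbedding_code.continuous_iff, continuous_pi_iff]
  intro s
  refine (uniformContinuous_code (D := D) (s - k)).continuous.congr fun x => ?_
  exact code_eq_code.2 ⟨marked_translate.symm, letter_translate.symm⟩

variable (D) in
/-- The action of `ℤ` on the subshift. -/
noncomputable def shiftHom : Multiplicative ℤ →* (D.Subshift ≃ₜ D.Subshift) where
  toFun k :=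
    { toFun := translate k.toAdd
      invFun := translate (-k.toAdd)
      left_inv := fun x => by rw [translate_translate, neg_add_cancel, translate_zero]
      right_inv := fun x => by rw [translate_translate, add_neg_cancel, translate_zero]
      continuous_toFun := continuous_translate _
      continuous_invFun := continuous_translate _ }
  map_one' := by ext x; exact translate_zero x
  map_mul' k l := by ext x; exact (translate_translate _ _ x).symm

variable (D) in
/-- The shift. -/
noncomputable def shift : D.Subshift ≃ₜ D.Subshift := shiftHom D (Multiplicative.ofAdd 1)

theorem shift_zpow_apply (k : ℤ) (x : D.Subshift) : (D.shift ^ k) x = translate k x := by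
  rw [shift, ← map_zpow, ← ofAdd_zsmul, zsmul_one]
  rfl

/-- The entourage compares only the mark at `0`. Along the orbit this reads every mark, hence the
translation and all block memberships, but no letter. -/
theorem isUniformlyNExpansive_shift {n : ℕ} (hn : 1 ≤ n)
    (hfib : ∀ y, {y' | ∀ i, y ∈ D.block i ↔ y' ∈ D.block i}.encard ≤ n) :
    IsUniformlyNExpansive n D.shift := by
  have hV : {p : D.Subshift × D.Subshift | D.Marked p.1 0 ↔ D.Marked p.2 0} ∈ 𝓤 D.Subshift := by
    have h1 : UniformContinuous fun x : D.Subshift => (D.code x 0).1 :=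
      uniformContinuous_fst.comp (uniformContinuous_code 0)
    have h2 : SetRel.id ∈ 𝓤 Bool := by
      rw [DiscreteUniformity.eq_principal_setRelId]; exact mem_principal_self _
    refine mem_of_superset (h1 h2) fun p hp => ?_
    have h3 : (D.code p.1 0).1 = (D.code p.2 0).1 := hp
    simpa [code] using h3
  refine ⟨_, hV, fun x => ?_⟩
  have hball : {y | ∀ k : ℤ, ((D.shift ^ k) x, (D.shift ^ k) y) ∈
      {p : D.Subshift × D.Subshift | D.Marked p.1 0 ↔ D.Marked p.2 0}} ⊆
      {y | ∀ s, D.Marked x s ↔ D.Marked y s} := by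
    intro y hy s
    have h1 := hy (-s)
    rw [mem_ofPred_eq, shift_zpow_apply, shift_zpow_apply, marked_translate, marked_translate] at h1
    simpa using h1
  refine (encard_le_encard hball).trans ?_
  rcases cases_pt x with rfl | ⟨t, y, rfl⟩
  · refine (encard_le_encard (t := {D.infty}) fun x hx => ?_).trans ?_
    · rcases cases_pt x with rfl | ⟨t, y, rfl⟩
      · rfl
      · exact absurd ((hx t).2 (marked_self _ _)) (marked_infty _)
    · rw [encard_singleton]
      exact_mod_cast hn
  · refine (encard_le_encard (t := D.pt t '' {y' | ∀ i, y ∈ D.block i ↔ y' ∈ D.block i})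
      fun x hx => ?_).trans ?_
    · rcases cases_pt x with rfl | ⟨t', y', rfl⟩
      · exact absurd ((hx t).1 (marked_self _ _)) (marked_infty _)
      · obtain rfl := eq_of_marked_iff hx
        refine ⟨y', fun i => ?_, rfl⟩
        have := hx (t + 3 ^ i)
        rwa [marked_add_three_pow, marked_add_three_pow] at this
    · rw [(pt_injective t).encard_image]
      exact hfib y

theorem not_isUniformlyNExpansive_shift {m : ℕ}
    (hbig : ∀ U ∈ 𝓝 D.base, ∃ F ⊆ U, (m : ℕ∞) < F.encard ∧
      ∀ y ∈ F, ∀ y' ∈ F, ∀ i, y ∈ D.block i ↔ y' ∈ D.block i) :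
    ¬ IsUniformlyNExpansive m D.shift := by
  rintro ⟨V, hV, h⟩
  -- The translation is left free, so closeness holds uniformly along whole orbits.
  let l : Filter (ℤ × Y × Y) := comap Prod.snd (𝓝 D.base ×ˢ 𝓝 D.base) ⊓
    𝓟 {p | ∀ i, p.2.1 ∈ D.block i ↔ p.2.2 ∈ D.block i}
  have key : Tendsto (fun p : ℤ × Y × Y => (D.pt p.1 p.2.1, D.pt p.1 p.2.2)) l (𝓤 D.Subshift) := by
    rw [← isUniformInducing_code.comap_uniformity, tendsto_comap_iff, Pi.uniformity, tendsto_iInf]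
    intro s
    rw [tendsto_comap_iff]
    intro W hW
    have hW2 : {q : Y × Y | ∀ b : Bool, ((b, q.1), (b, q.2)) ∈ W} ∈ 𝓤 Y := by
      have : {q : Y × Y | ∀ b : Bool, ((b, q.1), (b, q.2)) ∈ W} =
          ⋂ b : Bool, {q : Y × Y | ((b, q.1), (b, q.2)) ∈ W} := by ext q; simp
      rw [this, iInter_mem]
      intro b
      have hb : UniformContinuous (Prod.mk b : Y → Bool × Y) :=
        uniformContinuous_const.prodMk uniformContinuous_id
      exact hb hW
    have hnhds : {q : Y × Y | ∀ b : Bool, ((b, q.1), (b, q.2)) ∈ W} ∈ 𝓝 D.base ×ˢ 𝓝 D.base := by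
      rw [← nhds_prod_eq]
      exact nhds_le_uniformity _ hW2
    rw [mem_map, mem_inf_principal]
    filter_upwards [preimage_mem_comap hnhds] with p hp hcode
    have hm : (D.code (D.pt p.1 p.2.1) s).1 = (D.code (D.pt p.1 p.2.2) s).1 := by
      have h0 : ∀ i, p.2.1 ∈ D.block i ↔ p.2.2 ∈ D.block i := hcode
      have h1 : D.Marked (D.pt p.1 p.2.1) s ↔ D.Marked (D.pt p.1 p.2.2) s := by
        simp only [marked_pt, h0]
      exact decide_eq_decide.2 h1
    by_cases hs : s = p.1
    · have h1 : ((D.code (D.pt p.1 p.2.1) s).2, (D.code (D.pt p.1 p.2.2) s).2) = p.2 := by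
        simp [code, hs]
      have h2 : ∀ b : Bool, ((b, p.2.1), (b, p.2.2)) ∈ W := hp
      rw [← h1] at h2
      replace h2 := h2 (D.code (D.pt p.1 p.2.1) s).1
      nth_rw 2 [hm] at h2
      exact h2
    · have h1 : D.code (D.pt p.1 p.2.1) s = D.code (D.pt p.1 p.2.2) s :=
        Prod.ext hm (by simp [code, letter_of_ne hs])
      simp only [mem_preimage, Function.comp_apply, h1]
      exact refl_mem_uniformity hW
  have h1 := key hV
  rw [mem_map, mem_inf_principal, mem_comap] at h1
  obtain ⟨U', hU', hU'V⟩ := h1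
  obtain ⟨U, hU, hUU⟩ := mem_prod_same_iff.1 hU'
  obtain ⟨F, hFU, hFm, hF⟩ := hbig U hU
  obtain ⟨y, hy⟩ : F.Nonempty := by
    rw [← encard_pos]
    exact bot_le.trans_lt hFm
  refine (hFm.trans_le ?_).not_ge (h (D.pt 0 y))
  rw [← (pt_injective (D := D) 0).encard_image]
  refine encard_le_encard ?_
  rintro _ ⟨y', hy', rfl⟩ k
  rw [shift_zpow_apply, shift_zpow_apply, translate_pt, translate_pt]
  exact hU'V (show ((0 + k, y, y') : ℤ × Y × Y) ∈ Prod.snd ⁻¹' U' from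
    hUU ⟨hFU hy, hFU hy'⟩) (hF y hy y' hy')

end BlockCode

/-! ### Construction of the blocks -/

theorem IsCBRank.exists_seq_tendsto {Y : Type*} [MetricSpace Y] {r : Y → Ordinal}
    (hr : IsCBRank r) {q : Y} (hq : 0 < r q) :
    ∃ z : ℕ → Y, Function.Injective z ∧ (∀ j, r (z j) = 0) ∧ Tendsto z atTop (𝓝 q) := by
  have hpos : ∀ y, r y = 0 → 0 < dist y q := fun y hy =>
    dist_pos.2 fun h => by rw [← h, hy] at hq; exact hq.false
  -- Halving the distance to `q` at each step gives both injectivity and convergence.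
  obtain ⟨z, hz, hzz⟩ := exists_seq_of_forall_finset_exists (fun y => r y = 0)
    (fun y y' => dist y' q < dist y q / 2) (fun s hs => by
      have h1 : ∀ᶠ y in 𝓝 q, ∀ x ∈ s, dist y q < dist x q / 2 := by
        rw [Filter.eventually_all_finset]
        exact fun x hx => Metric.ball_mem_nhds q (half_pos (hpos x (hs x hx)))
      obtain ⟨U, hU, hUo, hqU⟩ := eventually_nhds_iff.1 h1
      obtain ⟨y, hyU, hy⟩ := hr.exists_mem_eq hUo hqU hq.le
      exact ⟨y, hy, hU y hyU⟩)
  have hhalf : ∀ j, dist (z j) q ≤ dist (z 0) q * (1 / 2) ^ j := by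
    intro j
    induction j with
    | zero => simp
    | succ j ih =>
      have := hzz j (j + 1) (Nat.lt_succ_self j)
      rw [pow_succ]
      linarith
  refine ⟨z, ?_, hz, ?_⟩
  · have hne : ∀ i j, i < j → z i ≠ z j := fun i j hij h => by
      have h1 := hzz i j hij
      rw [← h] at h1
      have h2 := hpos _ (hz i)
      linarith
    intro i j hij
    by_contra hne'
    rcases Ne.lt_or_gt hne' with h | h
    · exact hne i j h hij
    · exact hne j i h hij.symm
  · rw [tendsto_iff_dist_tendsto_zero]
    refine squeeze_zero (fun j => dist_nonneg) hhalf ?_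
    simpa using (tendsto_pow_atTop_nhds_zero_of_lt_one (r := (1 / 2 : ℝ)) (by norm_num)
      (by norm_num)).const_mul (dist (z 0) q)

theorem Nat.setOf_div_eq {n : ℕ} (hn : 0 < n) (m : ℕ) :
    {j : ℕ | j / n = m} = Ico (n * m) (n * m + n) := by
  ext j
  rw [mem_ofPred_eq, Nat.div_eq_iff hn, mem_Ico, mul_comm]
  omega

/-- A code whose fibres have at most `n` elements, and exactly `n` elements for fibres arbitrarily
close to the base point. -/
theorem exists_blockCode {Y : Type*} [MetricSpace Y] [CompactSpace Y] {r : Y → Ordinal}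
    (hr : IsCBRank r) {q : Y} (hq : 0 < r q) {n : ℕ} (hn : 1 ≤ n) :
    ∃ D : BlockCode Y, D.base = q ∧ (∀ y, y ≠ q → ∃ i, y ∈ D.block i) ∧
      (∀ y, {y' | ∀ i, y ∈ D.block i ↔ y' ∈ D.block i}.encard ≤ n) ∧
      ∀ U ∈ 𝓝 q, ∃ F ⊆ U, F.encard = n ∧
        ∀ y ∈ F, ∀ y' ∈ F, ∀ i, y ∈ D.block i ↔ y' ∈ D.block i := by
  have := hr.totallyDisconnectedSpace
  obtain ⟨z, hzinj, hz0, hzq⟩ := hr.exists_seq_tendsto hq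
  obtain ⟨A, hA, hAsurj⟩ := exists_seq_clopens Y
  -- Isolated points converging to `q`, bundled into consecutive groups of `n`; the blocks will be
  -- all clopen sets that avoid `q` and never split a group.
  let group : ℕ → Set Y := fun m => z '' {j | j / n = m}
  have hgroup : ∀ m, (group m).encard = n := by
    intro m
    rw [hzinj.encard_image, Nat.setOf_div_eq hn, ← Finset.coe_Ico, encard_coe_eq_coe_finsetCard,
      Nat.card_Ico, Nat.add_sub_cancel_left]
  have hzopen : ∀ j, IsOpen {z j} := by
    intro j
    rw [isOpen_singleton_iff_nhds_eq_pure]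
    refine le_antisymm ?_ (pure_le_nhds _)
    rw [le_pure_iff]
    filter_upwards [hr.eventually_ne_imp_lt (z j)] with y hy
    by_contra hne
    have := hy hne
    rw [hz0] at this
    exact not_lt_bot this
  have hgroupc : ∀ m, IsClopen (group m) := by
    intro m
    have hfin : (group m).Finite := finite_of_encard_eq_coe (hgroup m)
    refine ⟨hfin.isClosed, ?_⟩
    rw [← biUnion_of_singleton (group m)]
    exact isOpen_biUnion fun y ⟨j, _, hj⟩ => hj ▸ hzopen j
  have hzne : ∀ j, z j ≠ q := fun j h => by
    rw [← h, hz0] at hq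
    exact hq.false
  have hacc : IsClosed (insert q (range z)) := hzq.isCompact_insert_range.isClosed
  let good : Set Y → Prop := fun C =>
    IsClopen C ∧ q ∉ C ∧ ∀ i j, i / n = j / n → z i ∈ C → z j ∈ C
  have hgood_empty : good ∅ := ⟨isClopen_empty, notMem_empty _, fun _ _ _ h => h⟩
  have hsep : ∀ y y', y ≠ q → (y' ∉ ({y} : Set Y)) → (∀ m, y ∈ group m → y' ∉ group m) →
      ∃ C, good C ∧ y ∈ C ∧ y' ∉ C := by
    intro y y' hyq hyy' hgr
    by_cases hy : y ∈ range z
    · obtain ⟨j, rfl⟩ := hy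
      refine ⟨group (j / n), ⟨hgroupc _, ?_, ?_⟩, ⟨j, rfl, rfl⟩, hgr _ ⟨j, rfl, rfl⟩⟩
      · rintro ⟨i, -, hi⟩
        exact hzne i hi
      · rintro i i' hii ⟨l, hl, hli⟩
        rw [hzinj hli] at hl
        exact ⟨i', Eq.trans (Eq.symm hii) hl, rfl⟩
    · obtain ⟨C, hC, hyC, hCU⟩ := compact_exists_isClopen_in_isOpen
        (hacc.isOpen_compl.inter (isClosed_singleton (x := y')).isOpen_compl)
        (show y ∈ (insert q (range z))ᶜ ∩ {y'}ᶜ from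
          ⟨fun h => h.elim hyq hy, fun h => hyy' (Eq.symm h)⟩)
      refine ⟨C, ⟨hC, fun h => (hCU h).1 (Or.inl rfl), fun i j _ h => ?_⟩, hyC,
        fun h => (hCU h).2 rfl⟩
      exact absurd (Or.inr (mem_range_self i)) (hCU h).1
  classical
  let block : ℕ → Set Y := fun i => if good (A i) then A i else ∅
  have hblock : ∀ i, good (block i) := fun i => by
    dsimp only [block]
    split_ifs with h
    · exact h
    · exact hgood_empty
  have hblock' : ∀ C, good C → ∃ i, block i = C := fun C hC => by
    obtain ⟨i, rfl⟩ := hAsurj C hC.1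
    exact ⟨i, if_pos hC⟩
  have hfib : ∀ y y', (∀ i, y ∈ block i ↔ y' ∈ block i) → y ≠ q →
      y' ∈ ({y} : Set Y) ∨ ∃ m, y ∈ group m ∧ y' ∈ group m := by
    intro y y' h hyq
    by_contra! hcon
    obtain ⟨C, hC, hyC, hyC'⟩ := hsep y y' hyq hcon.1 hcon.2
    obtain ⟨i, rfl⟩ := hblock' C hC
    exact hyC' ((h i).1 hyC)
  refine ⟨⟨q, block, fun i => (hblock i).1, fun i => (hblock i).2.1⟩, rfl, ?_, ?_, ?_⟩
  · intro y hy
    obtain ⟨C, hC, hyC, -⟩ := hsep y q hy (fun h => hy (Eq.symm h))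
      (fun m _ ⟨j, _, hj⟩ => hzne j hj)
    obtain ⟨i, rfl⟩ := hblock' C hC
    exact ⟨i, hyC⟩
  · intro y
    have hn' : ({y} : Set Y).encard ≤ n := by rw [encard_singleton]; exact_mod_cast hn
    have hgdisj : ∀ m m', y ∈ group m → y ∈ group m' → m = m' := by
      rintro m m' ⟨j, rfl, rfl⟩ ⟨j', rfl, hj⟩
      rw [hzinj hj]
    by_cases hyq : y = q
    · refine (encard_le_encard fun y' hy' => ?_).trans hn'
      by_contra hne
      have hy'q : y' ≠ q := fun h => hne (h.trans hyq.symm)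
      rcases hfib y' y (fun i => (hy' i).symm) hy'q with h | ⟨m, -, j, -, hj⟩
      · exact hne (Eq.symm h)
      · exact hzne j (hj.trans hyq)
    · by_cases hyz : ∃ m, y ∈ group m
      · obtain ⟨m, hm⟩ := hyz
        refine (encard_le_encard (t := group m) fun y' hy' => ?_).trans (hgroup m).le
        rcases hfib y y' hy' hyq with h | ⟨m', h1, h2⟩
        · rwa [show y' = y from h]
        · rwa [hgdisj m m' hm h1]
      · refine (encard_le_encard fun y' hy' => ?_).trans hn'
        rcases hfib y y' hy' hyq with h | ⟨m', h1, h2⟩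
        · exact h
        · exact absurd ⟨m', h1⟩ hyz
  · intro U hU
    obtain ⟨N, hN⟩ := eventually_atTop.1 (hzq.eventually_mem hU)
    refine ⟨group N, ?_, hgroup N, ?_⟩
    · rintro _ ⟨j, hj, rfl⟩
      rw [Nat.setOf_div_eq hn] at hj
      exact hN j ((Nat.le_mul_of_pos_left N hn).trans hj.1)
    · rintro _ ⟨j, hj, rfl⟩ _ ⟨j', hj', rfl⟩ i
      have hjj : j / n = j' / n := Eq.trans hj (Eq.symm hj')
      exact ⟨(hblock i).2.2 j j' hjj, (hblock i).2.2 j' j hjj.symm⟩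

/-! ### Successor degree and conclusion -/

theorem IsCBRank.exists_isEssentiallyNExpansive {X : Type u} [MetricSpace X] [CompactSpace X]
    {r : X → Ordinal.{v}} (hr : IsCBRank r) {β : Ordinal.{v}} (hβ : 0 < β)
    (hle : ∀ x, r x ≤ β + 1) {p : X} (hp : r p = β + 1) {n : ℕ} (hn : 1 ≤ n) :
    ∃ T : X ≃ₜ X, IsEssentiallyNExpansive n T := by
  have := hr.totallyDisconnectedSpace
  obtain ⟨q, -, hq⟩ := hr.exists_mem_eq isOpen_univ (mem_univ p)
    (show β ≤ r p by rw [hp]; exact (Order.lt_succ β).le)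
  obtain ⟨U, hUq, hUo, hqU⟩ := eventually_nhds_iff.1 (hr.eventually_ne_imp_lt q)
  obtain ⟨K, hK, hqK, hKU⟩ := compact_exists_isClopen_in_isOpen hUo hqU
  have : CompactSpace K := isCompact_iff_compactSpace.1 hK.isClosed.isCompact
  have hrK : IsCBRank (r ∘ ((↑) : K → X)) :=
    hr.comp_isOpenEmbedding hK.isOpen.isOpenEmbedding_subtypeVal
  obtain ⟨D, hDq, hcov, hfib, hbig⟩ := exists_blockCode hrK (q := ⟨q, hqK⟩)
    (by rw [Function.comp_apply, hq]; exact hβ) hn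
  have hbase : r D.base = β := by rw [hDq, hq]
  have hlt : ∀ y : K, y ≠ D.base → r y < r D.base := by
    intro y hy
    rw [hbase, ← hq]
    exact hUq y (hKU y.2) fun h => hy (by rw [hDq]; exact Subtype.ext h)
  have hrank := D.isCBRank_rank hrK hlt (by rwa [hDq])
  -- One copy of the shift space per top point of `X`, to match the number of top points.
  let ι := {x : X // r x = β + 1}
  have hfin : (univ ∩ r ⁻¹' {β + 1}).Finite := hr.finite_top isCompact_univ fun x _ => hle x
  have : Finite ι := (hfin.subset fun x hx => ⟨mem_univ x, hx⟩ : {x | r x = β + 1}.Finite)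
  have : Nonempty ι := ⟨⟨p, hp⟩⟩
  have hranki : IsCBRank (fun a : ι × D.Subshift => D.rank (r ∘ (↑)) a.2) := hrank.comp_snd
  have htype : IsCBRank.SameType r (fun a : ι × D.Subshift => D.rank (r ∘ (↑)) a.2) univ univ := by
    have hsub : ∀ x : D.Subshift, x ≠ D.infty → D.rank (r ∘ ((↑) : K → X)) x ≤ β := by
      intro x hx
      rcases BlockCode.cases_pt x with rfl | ⟨t, y, rfl⟩
      · exact absurd rfl hx
      · by_cases hy : y = D.base
        · rw [hy]; exact hbase.le
        · exact (hlt y hy).le.trans hbase.le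
    have htop : D.rank (r ∘ ((↑) : K → X)) D.infty = β + 1 := congrArg (· + 1) hbase
    have h1 : univ ∩ r ⁻¹' {β + 1} = ((↑) : ι → X) '' univ := by
      rw [image_univ, univ_inter]
      exact (Subtype.range_coe (s := r ⁻¹' {β + 1})).symm
    have h2 : univ ∩ (fun a : ι × D.Subshift => D.rank (r ∘ ((↑) : K → X)) a.2) ⁻¹' {β + 1} =
        (fun i : ι => (i, D.infty)) '' univ := by
      rw [univ_inter]
      ext ⟨i, x⟩
      constructor
      · intro h
        refine ⟨i, mem_univ i, ?_⟩
        by_contra hne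
        have hx : x ≠ D.infty := fun hx => hne (by rw [hx])
        exact ((hsub x hx).trans_lt (Order.lt_succ β)).ne h
      · rintro ⟨j, -, hj⟩
        rw [← hj]
        exact htop
    refine Or.inr ⟨β + 1, fun x _ => hle x, fun a _ => ?_, ⟨p, mem_univ p, hp⟩, ?_⟩
    · by_cases ha : a.2 = D.infty
      · exact (show D.rank _ a.2 = β + 1 by rw [ha, htop]).le
      · exact (hsub _ ha).trans (Order.lt_succ β).le
    · rw [h1, h2, Subtype.val_injective.encard_image,
        Function.Injective.encard_image fun i j hij => congrArg Prod.fst hij]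
  obtain ⟨e⟩ := hr.nonempty_homeomorph hranki htype
  refine ⟨e.conjHom (Homeomorph.sndHom ι D.shift), ?_, ?_⟩
  · rw [isNExpansive_iff_isUniformlyNExpansive, isUniformlyNExpansive_conjHom_iff,
      isUniformlyNExpansive_sndHom_iff]
    exact D.isUniformlyNExpansive_shift hn hfib
  · rw [isNExpansive_iff_isUniformlyNExpansive, isUniformlyNExpansive_conjHom_iff,
      isUniformlyNExpansive_sndHom_iff]
    refine D.not_isUniformlyNExpansive_shift fun U hU => ?_
    rw [hDq] at hU
    obtain ⟨F, hFU, hF, h⟩ := hbig U hU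
    refine ⟨F, hFU, ?_, h⟩
    rw [hF]
    exact_mod_cast Nat.sub_lt hn one_pos

theorem theorem4p3 {X : Type u} [MetricSpace X] [CompactSpace X] {α : Ordinal.{u}}
    (hα : HasDerivedDegree X α) (hα2 : 2 ≤ α) (n : ℕ) (hn : 1 ≤ n) :
    (∃ T : X ≃ₜ X, IsEssentiallyNExpansive n T) ↔ ¬ Order.IsSuccLimit α := by
  obtain ⟨⟨p, hpα⟩, hempty⟩ := hα
  obtain ⟨r, hr, hriff⟩ := CantorBendixson.exists_isCBRank hempty
  have hle : ∀ x, r x ≤ α := fun x => Order.le_of_lt_succ (not_le.1 fun h => by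
    have h1 := (hriff x (α + 1)).2 h
    rw [hempty] at h1
    exact h1)
  have hp : r p = α := le_antisymm (hle p) ((hriff p α).1 hpα)
  constructor
  · rintro ⟨T, hT, -⟩ hlim
    exact hr.not_isNExpansive_of_isSuccLimit hlim hle hp T n hT
  · intro hlim
    rcases Ordinal.zero_or_succ_or_isSuccLimit α with rfl | ⟨β, rfl⟩ | h
    · exact absurd hα2 (not_le.2 two_pos)
    · refine hr.exists_isEssentiallyNExpansive (β := β) ?_ hle hp hn
      -- `β = 0` would mean `α = 1`; positivity of `β` is what supplies isolated points converging
      -- to `q`.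
      by_contra! h0
      have hb : β = 0 := le_bot_iff.1 h0
      subst hb
      simp at hα2
    · exact absurd h hlim
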